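/- Let $m\ge 0$ be an integer and let $\mathcal H_0^\Gamma$ be the set of smooth functions $\psi:\mathbb R^m\to\mathbb R$ that are $1$-periodic in each variable and satisfy $I+\operatorname{Hess}\psi>0$ everywhere. (These are the $(S^1)^m$-invariant Kähler potentials on $M=\mathbb C^m/(\mathbb Z^m+i\mathbb Z^m)$, $z=x+iy$, with local Kähler potential $\varphi(y)=2\pi y^2+4\pi\psi(y)$.) Let $\psi_t\in\mathcal H_0^\Gamma$, $t\in[0,1]$, be smooth in $(t,y)\in[0,1]\times\mathbb R^m$ and such that $\varphi_t=2\pi y^2+4\pi\psi_t$ is a geodesic of Kähler metrics, i.e. $$\ddot\varphi_t=(\nabla\dot\varphi_t)^{T}(\operatorname{Hess}\varphi_t)^{-1}\nabla\dot\varphi_t .$$ For $k\ge1$ and $j\in(\mathbb Z/k\mathbb Z)^m$ let $$\theta_j(z)=\sum_{n\in\mathbb Z^m}e^{-\pi\frac{(j+kn)^2}{k}+2\pi i(j+kn)\cdot z},\qquad \rho_k(j,t)=\int_{[0,1]^m\times[0,1]^m}|\theta_j(x+iy)|^2e^{-2k\pi y^2-4k\pi\psi_t(y)}(4\pi)^m\det(I+\operatorname{Hess}\psi_t(y))\,dx\,dy,$$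 $$R_k(j,t)=\frac{\rho_k(j,t)}{\rho_k(j,0)^{1-t}\rho_k(j,1)^t}.$$ Let $u_t(\mu)=\sup_{y\in\mathbb R^m}(\mu\cdot y-\varphi_t(y))$ be the Legendre transform of $\varphi_t$, and $$R_\infty(\mu,t)=\left(\frac{\det\operatorname{Hess}_\mu u_t}{(\det\operatorname{Hess}_\mu u_0)^{1-t}(\det\operatorname{Hess}_\mu u_1)^t}\right)^{-1/2}.$$ Then $R_\infty$ is a smooth function of $(\mu,t)\in\mathbb R^m\times[0,1]$, $4\pi$-periodic in each variable $\mu_\alpha$ for every fixed $t$, and there are functions $a_1,a_2,\dots$ of $(\mu,t)\in\mathbb R^m\times[0,1]$, smooth and $4\pi$-periodic in each $\mu_\alpha$ for every fixed $t$, such that for every integer $\nu\ge0$, as $k\to\infty$, $$R_k(j,t)=R_\infty(\mu,t)\left(1+k^{-1}a_1(\mu,t)+\cdots+k^{-\nu}a_\nu(\mu,t)\right)\Big|_{\mu=-4\pi j/k}+O(k^{-\nu-1}),$$ where the $O$ is uniform in $t\in[0,1]$ and in $j$. -/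

import Mathlib

open scoped ContDiff Matrix
open Filter

noncomputable section

/-- The `i`-th partial derivative of a real function on `ℝ^m`. -/
def partialDeriv {m : ℕ} (f : (Fin m → ℝ) → ℝ) (i : Fin m) (y : Fin m → ℝ) : ℝ :=
  fderiv ℝ f y (Pi.single i 1)

/-- The Hessian matrix of a real function on `ℝ^m`. -/
def hess {m : ℕ} (f : (Fin m → ℝ) → ℝ) (y : Fin m → ℝ) : Matrix (Fin m) (Fin m) ℝ :=
  Matrix.of fun i j => partialDeriv (partialDeriv f j) i y

/-- Functions on `ℝ^m` with period `c` in each variable. -/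
def IsPeriodicWith {m : ℕ} (c : ℝ) (f : (Fin m → ℝ) → ℝ) : Prop :=
  ∀ (n : Fin m → ℤ) (y : Fin m → ℝ), f (y + fun i => c * (n i : ℝ)) = f y

/-- The space of torus-invariant Kähler potentials on `ℂ^m / (ℤ^m + i ℤ^m)` relative to the flat
metric: an invariant smooth function depends on `y = Im z` only, is `1`-periodic in `y`, and the
Kähler form is positive exactly when `I + Hess ψ` is positive definite. -/
structure IsInvariantPotential {m : ℕ} (ψ : (Fin m → ℝ) → ℝ) : Prop where
  smooth : ContDiff ℝ ∞ ψ
  periodic : IsPeriodicWith 1 ψ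
  posDef : ∀ y, (1 + hess ψ y).PosDef

/-- The full Kähler potential `φ(y) = 2π y² + 4π ψ(y)` on the universal cover. -/
def kahlerPotential {m : ℕ} (ψ : (Fin m → ℝ) → ℝ) (y : Fin m → ℝ) : ℝ :=
  2 * Real.pi * (y ⬝ᵥ y) + 4 * Real.pi * ψ y

/-- The gradient in `y` of the velocity `∂φ_t/∂t` of a path of potentials. -/
def velocityGradient {m : ℕ} (ψ : ℝ → (Fin m → ℝ) → ℝ) (t : ℝ) (y : Fin m → ℝ) : Fin m → ℝ :=
  fun i => partialDeriv (fun x => deriv (fun s => kahlerPotential (ψ s) x) t) i y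

/-- A smooth geodesic `t ∈ [0,1] ↦ φ_t = 2π y² + 4π ψ_t` in the space of invariant Kähler metrics.
With `ω_t = (i/2) ∑ g_{αβ̄} dz_α ∧ dz̄_β`, `g_{αβ̄} = ∂_α ∂_β̄ φ_t = (1/4) (Hess φ_t)_{αβ}`, and
`∂_α φ̇_t = (1/(2i)) ∂φ̇_t/∂y_α`, the geodesic equation `φ̈ = |∂φ̇|²_ω = g^{αβ̄} ∂_α φ̇ ∂_β̄ φ̇` reads
`φ̈ = (∇φ̇)ᵀ (Hess φ)⁻¹ ∇φ̇`. -/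
structure IsSmoothGeodesic {m : ℕ} (ψ : ℝ → (Fin m → ℝ) → ℝ) : Prop where
  smooth : ContDiffOn ℝ ∞ (fun p : ℝ × (Fin m → ℝ) => ψ p.1 p.2)
    (Set.Icc (0 : ℝ) 1 ×ˢ (Set.univ : Set (Fin m → ℝ)))
  potential : ∀ t ∈ Set.Icc (0 : ℝ) 1, IsInvariantPotential (ψ t)
  geodesic : ∀ t ∈ Set.Ioo (0 : ℝ) 1, ∀ y : Fin m → ℝ,
    deriv (fun s => deriv (fun r => kahlerPotential (ψ r) y) s) t =
      velocityGradient ψ t y ⬝ᵥ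
        ((hess (kahlerPotential (ψ t)) y)⁻¹ *ᵥ velocityGradient ψ t y)

/-- The level `k` theta function
`θ_j(z) = ∑_{n ∈ ℤ^m} exp(-π (j+kn)²/k + 2πi (j+kn)·z)`.
It depends only on the class of `j` in `(ℤ/kℤ)^m`; `j` is given by an integer representative. -/
def thetaFun {m : ℕ} (k : ℕ) (j : Fin m → ℤ) (z : Fin m → ℂ) : ℂ :=
  ∑' n : Fin m → ℤ,
    Complex.exp (-(Real.pi : ℂ) * (∑ i, ((j i : ℂ) + (k : ℂ) * (n i : ℂ)) ^ 2) / (k : ℂ)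
      + 2 * (Real.pi : ℂ) * Complex.I * ∑ i, ((j i : ℂ) + (k : ℂ) * (n i : ℂ)) * z i)

/-- The squared Hilbert norm of a section `s` of `L^k` (a function of `z = x + iy` on `ℂ^m`)
for the metric `h^k`, `h = exp(-2π y² - 4π ψ(y))`, with volume form
`(4π)^m det(I + Hess ψ) dx dy`; the torus is integrated over the fundamental
domain `[0,1]^m × [0,1]^m`. -/
def sectionNormSq {m : ℕ} (ψ : (Fin m → ℝ) → ℝ) (k : ℕ) (s : (Fin m → ℂ) → ℂ) : ℝ :=
  ∫ p in (Set.Icc (0 : Fin m → ℝ) 1 ×ˢ Set.Icc (0 : Fin m → ℝ) 1),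
    ‖s (fun i => (p.1 i : ℂ) + Complex.I * (p.2 i : ℂ))‖ ^ 2
      * Real.exp (-2 * k * Real.pi * (p.2 ⬝ᵥ p.2) - 4 * k * Real.pi * ψ p.2)
      * ((4 * Real.pi) ^ m * (1 + hess ψ p.2).det)

/-- The norming constant `ρ_k(j,t) = ‖θ_j‖²` for the metric `h_t^k`. -/
def normingConst {m : ℕ} (ψ : ℝ → (Fin m → ℝ) → ℝ) (k : ℕ) (j : Fin m → ℤ) (t : ℝ) : ℝ :=
  sectionNormSq (ψ t) k (thetaFun k j)

/-- `R_k(j,t) = ρ_k(j,t) / (ρ_k(j,0)^{1-t} ρ_k(j,1)^t)`. -/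
def normingRatio {m : ℕ} (ψ : ℝ → (Fin m → ℝ) → ℝ) (k : ℕ) (j : Fin m → ℤ) (t : ℝ) : ℝ :=
  normingConst ψ k j t / (normingConst ψ k j 0 ^ (1 - t) * normingConst ψ k j 1 ^ t)

/-- The Legendre transform `u(μ) = sup_y (μ·y - φ(y))`. -/
def legendre {m : ℕ} (φ : (Fin m → ℝ) → ℝ) (μ : Fin m → ℝ) : ℝ :=
  ⨆ y : Fin m → ℝ, (μ ⬝ᵥ y - φ y)

/-- `det Hess_μ u_t`, where `u_t` is the Legendre transform of `φ_t`. -/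
def detHessLegendre {m : ℕ} (ψ : ℝ → (Fin m → ℝ) → ℝ) (μ : Fin m → ℝ) (t : ℝ) : ℝ :=
  (hess (legendre (kahlerPotential (ψ t))) μ).det

/-- `R_∞(μ,t) = (det Hess u_t / ((det Hess u_0)^{1-t} (det Hess u_1)^t))^{-1/2}`. -/
def limitRatio {m : ℕ} (ψ : ℝ → (Fin m → ℝ) → ℝ) (μ : Fin m → ℝ) (t : ℝ) : ℝ :=
  (detHessLegendre ψ μ t /
    (detHessLegendre ψ μ 0 ^ (1 - t) * detHessLegendre ψ μ 1 ^ t)) ^ (-(1 / 2) : ℝ)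

/-- Smooth functions of `(μ,t) ∈ ℝ^m × [0,1]`, `4π`-periodic in each `μ`-variable for fixed `t`. -/
def IsSmoothPeriodicSymbol {m : ℕ} (F : (Fin m → ℝ) → ℝ → ℝ) : Prop :=
  ContDiffOn ℝ ∞ (fun p : (Fin m → ℝ) × ℝ => F p.1 p.2)
      ((Set.univ : Set (Fin m → ℝ)) ×ˢ Set.Icc (0 : ℝ) 1) ∧
    ∀ t ∈ Set.Icc (0 : ℝ) 1, IsPeriodicWith (4 * Real.pi) (fun μ => F μ t)

/-- The point `μ = -4πj/k`. -/
def latticePoint {m : ℕ} (k : ℕ) (j : Fin m → ℤ) : Fin m → ℝ :=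
  fun i => -(4 * Real.pi * (j i : ℝ)) / (k : ℝ)

end

/-! Put `μ = -4πj/k`. As a function of `x`, `θ_j` is a Fourier series, so integrating `|θ_j|²` over
the `x`-torus leaves a sum over `n` of integrals over the unit `y`-cube. The summands are the
translates by `n ∈ ℤ^m` of one function, and the sum unfolds to `ρ_k(j,t) = ∫ exp(-k(φ_t(y) - μ·y +
|μ|²/8π)) det Hess φ_t(y) dy` over `ℝ^m` (`IsInvariantPotential.sectionNormSq_thetaFun`).

Substitute `p = ∇φ_t(y)`, whose Jacobian is the volume density. The phase becomes `-u_t(μ)` plus the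
Bregman divergence `u_t(μ) - u_t(p) + (p-μ)·∇u_t(p) = ∫₀¹ s (p-μ)ᵀ Hess u_t(μ + s(p-μ)) (p-μ) ds`.
Rescaling `p = μ + εw` with `ε = k^{-1/2}` gives the exact formula `ρ_k = exp(k(u_t(μ) - |μ|²/8π))
ε^m J(μ,t,ε)`, where `J` is `laplaceIntegral`.

The Legendre transform linearises the geodesic equation: `u_t = (1-t)u_0 + t u_1`
(`IsSmoothGeodesic.legendre_affine`). Hence the exponentials and the powers of `ε` cancel in the
ratio, and `R_k(j,t) = J(μ,t,ε) / (J(μ,0,ε)^{1-t} J(μ,1,ε)^t)` holds without error for every `k ≥ 1`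
(`IsSmoothGeodesic.normingRatio_eq`).

What remains is Taylor's formula for this ratio at `ε = 0`. Uniform ellipticity of `Hess u_t` makes
`J` smooth in `(μ,t,ε)`, even at `ε = 0`. The symmetry `w ↦ -w` makes it even in `ε`, so only powers
of `ε² = 1/k` occur. At `ε = 0` the integral is Gaussian and yields the determinants of `R_∞`.
Periodicity in `μ` and compactness make the remainder uniform (`exists_even_expansion`). -/

open MeasureTheory Topology

/-! ### Smooth dependence of integrals on parameters -/

/-- `f` is smooth and, over the parameter set `U`, each of its iterated derivatives is dominated by
an integrable function. -/
def DominatedDerivs {X W F : Type} [NormedAddCommGroup X] [NormedSpace ℝ X]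
    [NormedAddCommGroup W] [NormedSpace ℝ W] [MeasurableSpace W]
    [NormedAddCommGroup F] [NormedSpace ℝ F]
    (μ : Measure W) (U : Set X) (f : X × W → F) : Prop :=
  ContDiff ℝ ∞ f ∧ ∀ n : ℕ, ∃ b : W → ℝ, Integrable b μ ∧
    ∀ᵐ w ∂μ, ∀ x ∈ U, ‖iteratedFDeriv ℝ n f (x, w)‖ ≤ b w

namespace DominatedDerivs

variable {X W F : Type} [NormedAddCommGroup X] [NormedSpace ℝ X]
    [NormedAddCommGroup W] [NormedSpace ℝ W] [NormedAddCommGroup F] [NormedSpace ℝ F]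
    {U : Set X} {f : X × W → F}

theorem norm_iteratedFDeriv_fderiv_inl_le (hf : ContDiff ℝ ∞ f) (n : ℕ) (p : X × W) :
    ‖iteratedFDeriv ℝ n (fun p => (fderiv ℝ f p).comp (ContinuousLinearMap.inl ℝ X W)) p‖
      ≤ ‖iteratedFDeriv ℝ (n + 1) f p‖ := by
  have h1 : (fun p => (fderiv ℝ f p).comp (ContinuousLinearMap.inl ℝ X W))
      = ((ContinuousLinearMap.compL ℝ X (X × W) F).flip (ContinuousLinearMap.inl ℝ X W))
        ∘ (fderiv ℝ f) := rfl
  rw [h1]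
  have h2 : ContDiff ℝ ∞ (fderiv ℝ f) := hf.fderiv_right (by simp)
  refine (ContinuousLinearMap.norm_iteratedFDeriv_comp_left _ (h2.contDiffAt)
    (by exact_mod_cast le_top)).trans ?_
  rw [norm_iteratedFDeriv_fderiv]
  refine mul_le_of_le_one_left (norm_nonneg _) ?_
  refine ContinuousLinearMap.opNorm_le_bound _ zero_le_one fun A => ?_
  simp only [ContinuousLinearMap.flip_apply, ContinuousLinearMap.compL_apply, one_mul]
  refine (ContinuousLinearMap.opNorm_comp_le _ _).trans ?_
  exact mul_le_of_le_one_right (norm_nonneg _) (ContinuousLinearMap.norm_inl_le_one ℝ X W)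

variable [MeasurableSpace W] {μ : Measure W}

/-- Since the domination concerns the joint derivatives in `(x, w)`, passing to the partial
derivative in `x` only shifts the order by one. This closure drives the inductions on the order of
smoothness below, in which the target space varies. -/
theorem fderiv_inl (h : DominatedDerivs μ U f) :
    DominatedDerivs μ U (fun p => (fderiv ℝ f p).comp (ContinuousLinearMap.inl ℝ X W)) := by
  obtain ⟨hf, hb⟩ := h
  refine ⟨?_, fun n => ?_⟩
  · exact (hf.fderiv_right (m := ∞) (by simp)).clm_comp contDiff_const
  · obtain ⟨b, hb1, hb2⟩ := hb (n + 1)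
    exact ⟨b, hb1, hb2.mono fun w hw x hx =>
      (norm_iteratedFDeriv_fderiv_inl_le hf n _).trans (hw x hx)⟩

variable [OpensMeasurableSpace W]

theorem integrable_norm_iteratedFDeriv (h : DominatedDerivs μ U f) {x : X} (hx : x ∈ U) (n : ℕ) :
    Integrable (fun w => ‖iteratedFDeriv ℝ n f (x, w)‖) μ := by
  obtain ⟨hf, hb⟩ := h
  obtain ⟨b, hb1, hb2⟩ := hb n
  refine hb1.mono' ?_ (hb2.mono fun w hw => by simpa using hw x hx)
  have : Continuous fun w => ‖iteratedFDeriv ℝ n f (x, w)‖ :=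
    ((hf.continuous_iteratedFDeriv (m := n) (by exact_mod_cast le_top)).comp
      (by fun_prop : Continuous fun w : W => (x, w))).norm
  exact this.aestronglyMeasurable

variable [SecondCountableTopology W]

theorem integrable (h : DominatedDerivs μ U f) {x : X} (hx : x ∈ U) :
    Integrable (fun w => f (x, w)) μ := by
  have hc : Continuous fun w => f (x, w) := h.1.continuous.comp (by fun_prop)
  refine (h.integrable_norm_iteratedFDeriv hx 0).mono' hc.aestronglyMeasurable ?_
  simp

theorem hasFDerivAt (h : DominatedDerivs μ U f) (hU : IsOpen U) {x : X} (hx : x ∈ U) :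
    HasFDerivAt (fun x => ∫ w, f (x, w) ∂μ)
      (∫ w, (fderiv ℝ f (x, w)).comp (ContinuousLinearMap.inl ℝ X W) ∂μ) x := by
  obtain ⟨b, hb1, hb2⟩ := h.fderiv_inl.2 0
  have hc : ∀ x, Continuous fun w => f (x, w) := fun x => h.1.continuous.comp (by fun_prop)
  have hc' : Continuous fun w => (fderiv ℝ f (x, w)).comp (ContinuousLinearMap.inl ℝ X W) :=
    h.fderiv_inl.1.continuous.comp (by fun_prop : Continuous fun w : W => (x, w))
  refine hasFDerivAt_integral_of_dominated_of_fderiv_le (F := fun x w => f (x, w))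
    (F' := fun x w => (fderiv ℝ f (x, w)).comp (ContinuousLinearMap.inl ℝ X W))
    (bound := b) (hU.mem_nhds hx)
    (Eventually.of_forall fun x => (hc x).aestronglyMeasurable) (h.integrable hx)
    hc'.aestronglyMeasurable
    (hb2.mono fun w hw x hx => by simpa using hw x hx) hb1 (Eventually.of_forall fun w x _ => ?_)
  have h1 : HasFDerivAt f (fderiv ℝ f (x, w)) (x, w) :=
    (h.1.differentiable (by simp) _).hasFDerivAt
  exact h1.comp x (hasFDerivAt_prodMk_left x w)

theorem contDiffOn_nat (h : DominatedDerivs μ U f) (hU : IsOpen U) (n : ℕ) :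
    ContDiffOn ℝ n (fun x => ∫ w, f (x, w) ∂μ) U := by
  induction n generalizing F with
  | zero =>
    rw [Nat.cast_zero, contDiffOn_zero]
    exact fun x hx => (h.hasFDerivAt hU hx).continuousAt.continuousWithinAt
  | succ n ih =>
    rw [Nat.cast_succ, contDiffOn_succ_iff_fderiv_of_isOpen hU]
    refine ⟨fun x hx => (h.hasFDerivAt hU hx).differentiableAt.differentiableWithinAt, by simp, ?_⟩
    exact (ih h.fderiv_inl).congr fun x hx => (h.hasFDerivAt hU hx).fderiv

theorem contDiffOn (h : DominatedDerivs μ U f) (hU : IsOpen U) :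
    ContDiffOn ℝ ∞ (fun x => ∫ w, f (x, w) ∂μ) U :=
  contDiffOn_infty.2 fun n => h.contDiffOn_nat hU n

/-- Smoothness alone would not control growth at infinity; this estimate carries polynomial bounds
through an integral over `s`. -/
theorem norm_iteratedFDeriv_integral_le (h : DominatedDerivs μ U f) (hU : IsOpen U) (n : ℕ)
    {x : X} (hx : x ∈ U) :
    ‖iteratedFDeriv ℝ n (fun x => ∫ w, f (x, w) ∂μ) x‖
      ≤ ∫ w, ‖iteratedFDeriv ℝ n f (x, w)‖ ∂μ := by
  induction n generalizing F with
  | zero => simpa using norm_integral_le_integral_norm _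
  | succ n ih =>
    rw [← norm_iteratedFDeriv_fderiv]
    have he : fderiv ℝ (fun x => ∫ w, f (x, w) ∂μ) =ᶠ[𝓝 x]
        fun x => ∫ w, (fderiv ℝ f (x, w)).comp (ContinuousLinearMap.inl ℝ X W) ∂μ :=
      (hU.mem_nhds hx |> fun h' => Filter.eventually_of_mem h' fun y hy =>
        (h.hasFDerivAt hU hy).fderiv)
    rw [he.iteratedFDeriv ℝ n |>.eq_of_nhds]
    refine (ih h.fderiv_inl).trans ?_
    exact integral_mono (h.fderiv_inl.integrable_norm_iteratedFDeriv hx n)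
      (h.integrable_norm_iteratedFDeriv hx (n + 1))
      fun w => norm_iteratedFDeriv_fderiv_inl_le h.1 n _

end DominatedDerivs

/-! ### Gaussian domination and temperate growth -/

theorem exists_add_pow_le_mul_exp (c : ℝ) (hc : 0 < c) (N : ℕ) :
    ∃ C : ℝ, ∀ r : ℝ, 0 ≤ r → (1 + r) ^ N ≤ C * Real.exp (c * r ^ 2) := by
  refine ⟨2 ^ N * (1 + N.factorial / c ^ N), fun r hr => ?_⟩
  have h1 : 1 ≤ Real.exp (c * r ^ 2) := Real.one_le_exp (by positivity)
  have h2 : (r ^ 2) ^ N ≤ N.factorial / c ^ N * Real.exp (c * r ^ 2) := by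
    have := Real.pow_div_factorial_le_exp (c * r ^ 2) (by positivity) N
    rw [mul_pow, div_le_iff₀ (by positivity)] at this
    rw [div_mul_eq_mul_div, le_div_iff₀ (by positivity)]
    linarith
  have h3 : (1 + r) ^ N ≤ 2 ^ N * (1 + (r ^ 2) ^ N) := by
    rcases le_total r 1 with h | h
    · calc (1 + r) ^ N ≤ 2 ^ N := by gcongr; linarith
        _ ≤ _ := le_mul_of_one_le_right (by positivity) (by linarith [pow_nonneg (sq_nonneg r) N])
    · calc (1 + r) ^ N ≤ (2 * r ^ 2) ^ N := by gcongr; nlinarith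
        _ ≤ _ := by rw [mul_pow]; gcongr; linarith
  calc (1 + r) ^ N ≤ 2 ^ N * (1 + (r ^ 2) ^ N) := h3
    _ ≤ 2 ^ N * (Real.exp (c * r ^ 2) + N.factorial / c ^ N * Real.exp (c * r ^ 2)) := by gcongr
    _ = _ := by ring

section Gaussian

variable {W : Type} [NormedAddCommGroup W] [NormedSpace ℝ W] [FiniteDimensional ℝ W]
  [MeasurableSpace W] [BorelSpace W]

theorem integrable_add_norm_pow_mul_exp_neg (μ : Measure W) [μ.IsAddHaarMeasure]
    {c : ℝ} (hc : 0 < c) (N : ℕ) :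
    Integrable (fun w : W => (1 + ‖w‖) ^ N * Real.exp (-(c * ‖w‖ ^ 2))) μ := by
  obtain ⟨C, hC⟩ := exists_add_pow_le_mul_exp c hc (N + (Module.finrank ℝ W + 1))
  have hi : Integrable (fun w : W => (1 + ‖w‖) ^ (-((Module.finrank ℝ W + 1 : ℕ) : ℝ))) μ :=
    integrable_one_add_norm (by push_cast; linarith)
  refine (hi.const_mul C).mono' (by fun_prop) (Eventually.of_forall fun w => ?_)
  have h0 : 0 < 1 + ‖w‖ := by positivity
  rw [Real.norm_of_nonneg (by positivity), Real.rpow_neg h0.le, Real.rpow_natCast, Real.exp_neg,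
    ← div_eq_mul_inv, ← div_eq_mul_inv, div_le_div_iff₀ (Real.exp_pos _) (by positivity), ← pow_add]
  exact hC _ (norm_nonneg w)

/-- By Faà di Bruno, a derivative of `exp(-q)` is `exp(-q)` times a polynomial in derivatives of
`q`. These grow polynomially in `w`, uniformly for bounded `x`, and the quadratic lower bound on `q`
supplies a Gaussian that absorbs them. -/
theorem dominatedDerivs_exp_neg {X : Type} [NormedAddCommGroup X] [NormedSpace ℝ X]
    (μ : Measure W) [μ.IsAddHaarMeasure] {q : X × W → ℝ} (hq : q.HasTemperateGrowth)
    {U : Set X} {R c : ℝ} (hR : 0 ≤ R) (hU : ∀ x ∈ U, ‖x‖ ≤ R) (hc : 0 < c)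
    (hqc : ∀ x ∈ U, ∀ w, c * ‖w‖ ^ 2 ≤ q (x, w)) :
    DominatedDerivs μ U (fun p => Real.exp (-q p)) := by
  refine ⟨Real.contDiff_exp.comp hq.1.neg, fun n => ?_⟩
  obtain ⟨k, C, hC0, hC⟩ := hq.norm_iteratedFDeriv_le_uniform n
  refine ⟨fun w => n.factorial * ((1 + C) * (1 + R) ^ k) ^ n *
    ((1 + ‖w‖) ^ (k * n) * Real.exp (-(c * ‖w‖ ^ 2))),
    (integrable_add_norm_pow_mul_exp_neg μ hc _).const_mul _,
    Eventually.of_forall fun w x hx => ?_⟩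
  -- The composition estimate asks for the bound `D ^ i` on the derivative of order `i ≥ 1`. One `D`
  -- bounds all orders up to `n`, and `1 ≤ D` gives `D ≤ D ^ i`; hence `1 + C` in place of `C`.
  have hD : 1 ≤ (1 + C) * ((1 + R) * (1 + ‖w‖)) ^ k := by
    refine one_le_mul_of_one_le_of_one_le (by linarith) (one_le_pow₀ ?_)
    exact one_le_mul_of_one_le_of_one_le (by linarith) (by linarith [norm_nonneg w])
  have h := norm_iteratedFDeriv_comp_le (g := Real.exp) (f := fun p => -q p) (n := n) (N := ∞)
    Real.contDiff_exp hq.1.neg (by exact_mod_cast le_top) (x, w)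
    (C := Real.exp (-(c * ‖w‖ ^ 2))) (D := (1 + C) * ((1 + R) * (1 + ‖w‖)) ^ k) ?_ ?_
  · refine h.trans (le_of_eq ?_)
    simp only [mul_pow, pow_mul]
    ring
  · intro i _
    rw [norm_iteratedFDeriv_eq_norm_iteratedDeriv, iteratedDeriv_eq_iterate, Real.iter_deriv_exp,
      Real.norm_of_nonneg (Real.exp_pos _).le]
    exact Real.exp_le_exp.2 (neg_le_neg (hqc x hx w))
  · intro i hi hin
    have hx' : ‖(x, w)‖ ≤ R + ‖w‖ := by
      rw [Prod.norm_def]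
      exact max_le (by linarith [hU x hx, norm_nonneg w]) (by linarith)
    have e : (fun p => -q p) = -q := rfl
    rw [e, iteratedFDeriv_neg_apply, norm_neg]
    refine (hC i hin (x, w)).trans (le_trans ?_ (le_self_pow₀ hD (by omega)))
    gcongr
    · linarith
    · nlinarith [norm_nonneg w]

end Gaussian

/-- For `s ∈ [0,1]` one has `1 + ‖(y,s)‖ ≤ 2(1 + ‖y‖)`, so the growth of `h` is uniform in `s`.
Domination is only available on balls, but the constants `k` and `C` do not depend on the ball. -/
theorem Function.HasTemperateGrowth.setIntegral_unitInterval {Y F : Type} [NormedAddCommGroup Y]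
    [NormedSpace ℝ Y] [NormedAddCommGroup F] [NormedSpace ℝ F] {h : Y × ℝ → F}
    (hh : h.HasTemperateGrowth) :
    (fun y => ∫ s in Set.Icc (0 : ℝ) 1, h (y, s)).HasTemperateGrowth := by
  have key : ∀ n : ℕ, ∃ (k : ℕ) (C : ℝ), 0 ≤ C ∧ ∀ y, ∀ s ∈ Set.Icc (0 : ℝ) 1,
      ‖iteratedFDeriv ℝ n h (y, s)‖ ≤ C * (1 + ‖y‖) ^ k := by
    intro n
    obtain ⟨k, C, hC0, hC⟩ := hh.norm_iteratedFDeriv_le_uniform n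
    refine ⟨k, C * 2 ^ k, by positivity, fun y s hs => (hC n le_rfl _).trans ?_⟩
    have : ‖(y, s)‖ ≤ ‖y‖ + 1 := by
      rw [Prod.norm_def]
      refine max_le (by linarith) ?_
      simp only [Real.norm_eq_abs, abs_of_nonneg hs.1]
      linarith [hs.2, norm_nonneg y]
    rw [mul_assoc, ← mul_pow]
    gcongr
    linarith [norm_nonneg y]
  have hdom : ∀ R : ℝ, DominatedDerivs (volume.restrict (Set.Icc (0 : ℝ) 1))
      (Metric.ball (0 : Y) R) h := by
    refine fun R => ⟨hh.1, fun n => ?_⟩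
    obtain ⟨k, C, hC0, hC⟩ := key n
    refine ⟨fun _ => C * (1 + R) ^ k, integrable_const _, ?_⟩
    refine (ae_restrict_mem measurableSet_Icc).mono fun s hs y hy => (hC y s hs).trans ?_
    have := (mem_ball_zero_iff.1 hy).le
    dsimp only
    gcongr
  refine ⟨contDiff_iff_contDiffAt.2 fun y => ?_, fun n => ?_⟩
  · have hy : y ∈ Metric.ball (0 : Y) (‖y‖ + 1) := by simp
    exact ((hdom (‖y‖ + 1)).contDiffOn Metric.isOpen_ball).contDiffAt
      (Metric.isOpen_ball.mem_nhds hy)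
  · obtain ⟨k, C, hC0, hC⟩ := key n
    refine ⟨k, C, fun y => ?_⟩
    have hy : y ∈ Metric.ball (0 : Y) (‖y‖ + 1) := by simp
    refine ((hdom (‖y‖ + 1)).norm_iteratedFDeriv_integral_le Metric.isOpen_ball n hy).trans ?_
    refine (integral_mono_ae ((hdom (‖y‖ + 1)).integrable_norm_iteratedFDeriv hy n)
      (integrable_const (C * (1 + ‖y‖) ^ k)) ?_).trans ?_
    · exact (ae_restrict_mem measurableSet_Icc).mono fun s hs => hC y s hs
    · simp

/-! ### Periodic functions: global bounds from a compact cell -/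

section Periodic

variable {m : ℕ}

theorem exists_add_mem_Icc {c : ℝ} (hc : 0 < c) (y : Fin m → ℝ) :
    ∃ n : Fin m → ℤ, (y + fun i => c * (n i : ℝ)) ∈ Set.Icc (0 : Fin m → ℝ) (fun _ => c) := by
  refine ⟨fun i => -⌊y i / c⌋, fun i => ?_, fun i => ?_⟩
  · have h1 := Int.floor_le (y i / c)
    rw [le_div_iff₀ hc] at h1
    simp only [Pi.zero_apply, Pi.add_apply]
    push_cast
    linarith
  · have h1 := Int.lt_floor_add_one (y i / c)
    rw [div_lt_iff₀ hc] at h1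
    simp only [Pi.add_apply]
    push_cast
    linarith

theorem exists_bound_of_periodic {c : ℝ} (hc : 0 < c) {f : (Fin m → ℝ) → ℝ} (hf : Continuous f)
    (hp : IsPeriodicWith c f) : ∃ C, ∀ y, f y ≤ C := by
  obtain ⟨C, hC⟩ := (isCompact_Icc (a := (0 : Fin m → ℝ)) (b := fun _ => c)).bddAbove_image
    hf.continuousOn
  refine ⟨C, fun y => ?_⟩
  obtain ⟨n, hn⟩ := exists_add_mem_Icc hc y
  rw [← hp n y]
  exact hC ⟨_, hn, rfl⟩

theorem IsPeriodicWith.hasTemperateGrowth {c : ℝ} (hc : 0 < c) {f : (Fin m → ℝ) → ℝ}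
    (hp : IsPeriodicWith c f) (hf : ContDiff ℝ ∞ f) : f.HasTemperateGrowth := by
  refine ⟨hf, fun n => ?_⟩
  obtain ⟨C, hC⟩ := exists_bound_of_periodic (f := fun y => ‖iteratedFDeriv ℝ n f y‖) hc
    (hf.continuous_iteratedFDeriv (m := n) (by exact_mod_cast le_top)).norm (fun l y => by
      dsimp only
      rw [← iteratedFDeriv_comp_add_right, funext (hp l)])
  exact ⟨0, C, fun y => by simpa using hC y⟩

/-- By periodicity and homogeneity it suffices to minimise over the compact product of a period cell
and the unit sphere. -/
theorem exists_quadratic_lower_bound {c : ℝ} (hc : 0 < c)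
    {A : (Fin m → ℝ) → Matrix (Fin m) (Fin m) ℝ} (hA : Continuous A)
    (hp : ∀ (n : Fin m → ℤ) y, A (y + fun i => c * (n i : ℝ)) = A y)
    (hpos : ∀ y w, w ≠ 0 → 0 < w ⬝ᵥ A y *ᵥ w) :
    ∃ d > 0, ∀ y w, d * ‖w‖ ^ 2 ≤ w ⬝ᵥ A y *ᵥ w := by
  have hcont : Continuous fun p : (Fin m → ℝ) × (Fin m → ℝ) => p.2 ⬝ᵥ A p.1 *ᵥ p.2 :=
    continuous_snd.dotProduct ((hA.comp continuous_fst).matrix_mulVec continuous_snd)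
  have hK : IsCompact (Set.Icc (0 : Fin m → ℝ) (fun _ => c) ×ˢ
      Metric.sphere (0 : Fin m → ℝ) 1) := isCompact_Icc.prod (isCompact_sphere _ _)
  obtain ⟨d, hd, hd'⟩ := hK.exists_forall_le' hcont.continuousOn (a := 0) (fun p hp' =>
    hpos _ _ (by
      have : ‖p.2‖ = 1 := by simpa using hp'.2
      intro h; simp [h] at this))
  refine ⟨d, hd, fun y w => ?_⟩
  obtain ⟨n, hn⟩ := exists_add_mem_Icc hc y
  rw [← hp n y]
  by_cases hw : w = 0
  · simp [hw]
  have hw' : 0 < ‖w‖ := norm_pos_iff.2 hw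
  have := hd' (_, ‖w‖⁻¹ • w) ⟨hn, by simp [norm_smul, hw'.ne']⟩
  simp only [Matrix.mulVec_smul, smul_dotProduct, dotProduct_smul, smul_eq_mul] at this
  calc d * ‖w‖ ^ 2 ≤ (‖w‖⁻¹ * (‖w‖⁻¹ * (w ⬝ᵥ A (y + fun i => c * (n i : ℝ)) *ᵥ w))) * ‖w‖ ^ 2 := by
        gcongr
    _ = _ := by field_simp

theorem exists_quadratic_upper_bound {c : ℝ} (hc : 0 < c)
    {A : (Fin m → ℝ) → Matrix (Fin m) (Fin m) ℝ} (hA : Continuous A)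
    (hp : ∀ (n : Fin m → ℤ) y, A (y + fun i => c * (n i : ℝ)) = A y) :
    ∃ d, ∀ y w, w ⬝ᵥ A y *ᵥ w ≤ d * ‖w‖ ^ 2 := by
  have hcont : Continuous fun p : (Fin m → ℝ) × (Fin m → ℝ) => p.2 ⬝ᵥ A p.1 *ᵥ p.2 :=
    continuous_snd.dotProduct ((hA.comp continuous_fst).matrix_mulVec continuous_snd)
  have hK : IsCompact (Set.Icc (0 : Fin m → ℝ) (fun _ => c) ×ˢ
      Metric.sphere (0 : Fin m → ℝ) 1) := isCompact_Icc.prod (isCompact_sphere _ _)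
  obtain ⟨d, hd⟩ := hK.bddAbove_image hcont.continuousOn
  refine ⟨d, fun y w => ?_⟩
  obtain ⟨n, hn⟩ := exists_add_mem_Icc hc y
  rw [← hp n y]
  by_cases hw : w = 0
  · simp [hw]
  have hw' : 0 < ‖w‖ := norm_pos_iff.2 hw
  have : _ ≤ d := hd ⟨(_, ‖w‖⁻¹ • w), ⟨hn, by simp [norm_smul, hw'.ne']⟩, rfl⟩
  simp only [Matrix.mulVec_smul, smul_dotProduct, dotProduct_smul, smul_eq_mul] at this
  calc _ = (‖w‖⁻¹ * (‖w‖⁻¹ * (w ⬝ᵥ A (y + fun i => c * (n i : ℝ)) *ᵥ w))) * ‖w‖ ^ 2 := by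
        field_simp
    _ ≤ d * ‖w‖ ^ 2 := by gcongr

end Periodic

section

variable {X E F : Type} [NormedAddCommGroup X] [NormedSpace ℝ X] [NormedAddCommGroup E]
  [NormedSpace ℝ E] [NormedAddCommGroup F] [NormedSpace ℝ F]

@[fun_prop]
theorem Function.HasTemperateGrowth.fst {f : X → E × F} (hf : f.HasTemperateGrowth) :
    (fun x => (f x).1).HasTemperateGrowth :=
  (ContinuousLinearMap.fst ℝ E F).hasTemperateGrowth.comp hf

@[fun_prop]
theorem Function.HasTemperateGrowth.snd {f : X → E × F} (hf : f.HasTemperateGrowth) :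
    (fun x => (f x).2).HasTemperateGrowth :=
  (ContinuousLinearMap.snd ℝ E F).hasTemperateGrowth.comp hf

end

/-! ### The rescaled Laplace integral of two periodic metrics -/

/-- A smooth positive definite matrix field on `ℝ^m` with period `4π` in each variable. -/
structure IsPeriodicMetric {m : ℕ} (H : (Fin m → ℝ) → Matrix (Fin m) (Fin m) ℝ) : Prop where
  smooth : ∀ i j, ContDiff ℝ ∞ fun μ => H μ i j
  periodic : ∀ (n : Fin m → ℤ) μ, H (μ + fun i => 4 * Real.pi * (n i : ℝ)) = H μ
  posDef : ∀ μ, (H μ).PosDef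

/-- The affine interpolation of two matrix fields. -/
noncomputable def interpField {m : ℕ} (H₀ H₁ : (Fin m → ℝ) → Matrix (Fin m) (Fin m) ℝ) (t : ℝ)
    (μ : Fin m → ℝ) : Matrix (Fin m) (Fin m) ℝ :=
  (1 - t) • H₀ μ + t • H₁ μ

/-- The rescaled Bregman phase `∫₀¹ s wᵀ H_t(μ + s ε w) w ds` as a function of `((μ, t, ε), w)`. -/
noncomputable def bregmanPhase {m : ℕ} (H₀ H₁ : (Fin m → ℝ) → Matrix (Fin m) (Fin m) ℝ)
    (p : ((Fin m → ℝ) × ℝ × ℝ) × (Fin m → ℝ)) : ℝ :=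
  ∫ s in Set.Icc (0 : ℝ) 1,
    s * (p.2 ⬝ᵥ interpField H₀ H₁ p.1.2.1 (p.1.1 + (s * p.1.2.2) • p.2) *ᵥ p.2)

/-- The rescaled Laplace integral `∫ exp(-phase)` as a function of `(μ, t, ε)`. -/
noncomputable def laplaceIntegral {m : ℕ} (H₀ H₁ : (Fin m → ℝ) → Matrix (Fin m) (Fin m) ℝ)
    (x : (Fin m → ℝ) × ℝ × ℝ) : ℝ :=
  ∫ w, Real.exp (-bregmanPhase H₀ H₁ (x, w))

section

variable {m : ℕ} {H₀ H₁ : (Fin m → ℝ) → Matrix (Fin m) (Fin m) ℝ}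

theorem IsPeriodicMetric.continuous {H : (Fin m → ℝ) → Matrix (Fin m) (Fin m) ℝ}
    (h : IsPeriodicMetric H) : Continuous H :=
  continuous_matrix fun i j => (h.smooth i j).continuous

theorem interpField_quadratic (t : ℝ) (μ w : Fin m → ℝ) :
    w ⬝ᵥ interpField H₀ H₁ t μ *ᵥ w = (1 - t) * (w ⬝ᵥ H₀ μ *ᵥ w) + t * (w ⬝ᵥ H₁ μ *ᵥ w) := by
  simp [interpField, Matrix.add_mulVec, Matrix.smul_mulVec, dotProduct_add, dotProduct_smul]

theorem bregmanPhase_integrand_hasTemperateGrowth (h₀ : IsPeriodicMetric H₀)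
    (h₁ : IsPeriodicMetric H₁) :
    (fun p : (((Fin m → ℝ) × ℝ × ℝ) × (Fin m → ℝ)) × ℝ => p.2 * (p.1.2 ⬝ᵥ
      interpField H₀ H₁ p.1.1.2.1 (p.1.1.1 + (p.2 * p.1.1.2.2) • p.1.2) *ᵥ
        p.1.2)).HasTemperateGrowth := by
  have e : ∀ H : (Fin m → ℝ) → Matrix (Fin m) (Fin m) ℝ, IsPeriodicMetric H → ∀ i j,
      (fun p : (((Fin m → ℝ) × ℝ × ℝ) × (Fin m → ℝ)) × ℝ =>
        H (p.1.1.1 + (p.2 * p.1.1.2.2) • p.1.2) i j).HasTemperateGrowth := by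
    intro H hH i j
    have h1 : (fun μ => H μ i j).HasTemperateGrowth :=
      IsPeriodicWith.hasTemperateGrowth (c := 4 * Real.pi) (by positivity)
        (fun n y => by simp only [hH.periodic]) (hH.smooth i j)
    refine h1.comp (f := fun p : (((Fin m → ℝ) × ℝ × ℝ) × (Fin m → ℝ)) × ℝ =>
        (p.1.1.1 + (p.2 * p.1.1.2.2) • p.1.2)) ?_
    fun_prop
  have hw : ∀ i, (fun p : (((Fin m → ℝ) × ℝ × ℝ) × (Fin m → ℝ)) × ℝ =>
      p.1.2 i).HasTemperateGrowth := fun i =>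
    ((ContinuousLinearMap.proj (R := ℝ) (φ := fun _ : Fin m => ℝ) i).comp
      ((ContinuousLinearMap.snd ℝ _ _).comp (ContinuousLinearMap.fst ℝ
        (((Fin m → ℝ) × ℝ × ℝ) × (Fin m → ℝ)) ℝ))).hasTemperateGrowth
  have e0 := e H₀ h₀
  have e1 := e H₁ h₁
  simp only [dotProduct, Matrix.mulVec, interpField, Matrix.add_apply, Matrix.smul_apply,
    smul_eq_mul]
  refine .fun_mul (by fun_prop) (.sum fun i _ => .fun_mul (hw i) (.sum fun j _ => .fun_mul
    (.fun_add (.fun_mul (by fun_prop) (e0 i j)) (.fun_mul (by fun_prop) (e1 i j))) (hw j)))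

theorem bregmanPhase_hasTemperateGrowth (h₀ : IsPeriodicMetric H₀) (h₁ : IsPeriodicMetric H₁) :
    (bregmanPhase H₀ H₁).HasTemperateGrowth :=
  (bregmanPhase_integrand_hasTemperateGrowth h₀ h₁).setIntegral_unitInterval

end

section

variable {m : ℕ} {H₀ H₁ : (Fin m → ℝ) → Matrix (Fin m) (Fin m) ℝ}

/-- Ellipticity persists slightly beyond `[0,1]`, so smoothness in `t` up to the endpoints can be
proved on an open set. -/
theorem IsPeriodicMetric.exists_interpField_lower_bound (h₀ : IsPeriodicMetric H₀)
    (h₁ : IsPeriodicMetric H₁) :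
    ∃ δ > 0, ∃ c > 0, ∀ t ∈ Set.Ioo (-δ) (1 + δ), ∀ μ w : Fin m → ℝ,
      c * ‖w‖ ^ 2 ≤ w ⬝ᵥ interpField H₀ H₁ t μ *ᵥ w := by
  have hπ : 0 < 4 * Real.pi := by positivity
  have pos : ∀ H : (Fin m → ℝ) → Matrix (Fin m) (Fin m) ℝ, IsPeriodicMetric H →
      ∀ y w, w ≠ 0 → 0 < w ⬝ᵥ H y *ᵥ w := fun H hH y w hw => by
    simpa using (hH.posDef y).dotProduct_mulVec_pos hw
  obtain ⟨c₀, hc₀, hl₀⟩ := exists_quadratic_lower_bound hπ h₀.continuous h₀.periodic (pos H₀ h₀)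
  obtain ⟨c₁, hc₁, hl₁⟩ := exists_quadratic_lower_bound hπ h₁.continuous h₁.periodic (pos H₁ h₁)
  obtain ⟨d₀, hu₀⟩ := exists_quadratic_upper_bound hπ h₀.continuous h₀.periodic
  obtain ⟨d₁, hu₁⟩ := exists_quadratic_upper_bound hπ h₁.continuous h₁.periodic
  set c := min c₀ c₁ with hc
  set d := max (max d₀ d₁) 1 with hd
  have hcpos : 0 < c := lt_min hc₀ hc₁
  have hdpos : 0 < d := lt_of_lt_of_le one_pos (le_max_right _ _)
  -- Overshooting by at most `δ` subtracts at most `δ d ‖w‖²`, where `d` bounds both forms from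
  -- above; `δ = c / (2d)` makes this half of the lower bound `c ‖w‖²`.
  refine ⟨c / (2 * d), by positivity, c / 2, by positivity, fun t ht μ w => ?_⟩
  have hδ : c / (2 * d) * d = c / 2 := by field_simp
  rw [interpField_quadratic]
  have hn : 0 ≤ ‖w‖ ^ 2 := by positivity
  have a0 : c * ‖w‖ ^ 2 ≤ w ⬝ᵥ H₀ μ *ᵥ w :=
    le_trans (by gcongr; exact min_le_left _ _) (hl₀ μ w)
  have a1 : c * ‖w‖ ^ 2 ≤ w ⬝ᵥ H₁ μ *ᵥ w :=
    le_trans (by gcongr; exact min_le_right _ _) (hl₁ μ w)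
  have b0 : w ⬝ᵥ H₀ μ *ᵥ w ≤ d * ‖w‖ ^ 2 :=
    (hu₀ μ w).trans (by gcongr; exact (le_max_left _ _).trans (le_max_left _ _))
  have b1 : w ⬝ᵥ H₁ μ *ᵥ w ≤ d * ‖w‖ ^ 2 :=
    (hu₁ μ w).trans (by gcongr; exact (le_max_right _ _).trans (le_max_left _ _))
  generalize w ⬝ᵥ H₀ μ *ᵥ w = q₀ at *
  generalize w ⬝ᵥ H₁ μ *ᵥ w = q₁ at *
  generalize ‖w‖ ^ 2 = N at *
  generalize c / (2 * d) = δ at *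
  obtain ⟨ht1, ht2⟩ := ht
  have hcN : 0 ≤ c * N := by positivity
  have hdN : 0 ≤ d * N := by positivity
  have hδN : δ * (d * N) = c / 2 * N := by rw [← mul_assoc, hδ]
  rcases lt_or_ge t 0 with h | h
  · have e1 : (1 - t) * (c * N) ≤ (1 - t) * q₀ := by gcongr; linarith
    have e2 : (-t) * q₁ ≤ (-t) * (d * N) := by gcongr; linarith
    have e3 : (-t) * (d * N) ≤ δ * (d * N) := by gcongr; linarith
    nlinarith
  · rcases lt_or_ge 1 t with h' | h'
    · have e1 : t * (c * N) ≤ t * q₁ := by gcongr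
      have e2 : (t - 1) * q₀ ≤ (t - 1) * (d * N) := by gcongr
      have e3 : (t - 1) * (d * N) ≤ δ * (d * N) := by gcongr; linarith
      nlinarith
    · have e1 : (1 - t) * (c * N) ≤ (1 - t) * q₀ := by gcongr
      have e2 : t * (c * N) ≤ t * q₁ := by gcongr
      nlinarith

theorem bregmanPhase_integrand_integrable (h₀ : IsPeriodicMetric H₀) (h₁ : IsPeriodicMetric H₁)
    (p : ((Fin m → ℝ) × ℝ × ℝ) × (Fin m → ℝ)) :
    IntegrableOn (fun s : ℝ => s * (p.2 ⬝ᵥ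
      interpField H₀ H₁ p.1.2.1 (p.1.1 + (s * p.1.2.2) • p.2) *ᵥ p.2)) (Set.Icc 0 1) := by
  have := (bregmanPhase_integrand_hasTemperateGrowth h₀ h₁).1.continuous.comp
    (by fun_prop : Continuous fun s : ℝ => (p, s))
  exact this.continuousOn.integrableOn_Icc

theorem setIntegral_id_mul_const (q : ℝ) : ∫ s in Set.Icc (0 : ℝ) 1, s * q = q / 2 := by
  rw [integral_Icc_eq_integral_Ioc, ← intervalIntegral.integral_of_le zero_le_one,
    intervalIntegral.integral_mul_const, integral_id]
  ring

theorem bregmanPhase_lower_bound (h₀ : IsPeriodicMetric H₀) (h₁ : IsPeriodicMetric H₁)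
    {t c : ℝ} (hc : ∀ μ w : Fin m → ℝ, c * ‖w‖ ^ 2 ≤ w ⬝ᵥ interpField H₀ H₁ t μ *ᵥ w)
    (μ w : Fin m → ℝ) (ε : ℝ) : c / 2 * ‖w‖ ^ 2 ≤ bregmanPhase H₀ H₁ ((μ, t, ε), w) := by
  have : ∫ s in Set.Icc (0 : ℝ) 1, s * (c * ‖w‖ ^ 2) ≤ bregmanPhase H₀ H₁ ((μ, t, ε), w) := by
    refine setIntegral_mono_on ?_ (bregmanPhase_integrand_integrable h₀ h₁ _) measurableSet_Icc
      fun s hs => mul_le_mul_of_nonneg_left (hc _ _) hs.1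
    exact (by fun_prop : Continuous fun s : ℝ => s * (c * ‖w‖ ^ 2)).continuousOn.integrableOn_Icc
  rw [setIntegral_id_mul_const] at this
  linarith

/-- The parameter domain `ℝ^m × (-δ, 1 + δ) × ℝ`. -/
def paramDomain (m : ℕ) (δ : ℝ) : Set ((Fin m → ℝ) × ℝ × ℝ) :=
  {x | x.2.1 ∈ Set.Ioo (-δ) (1 + δ)}

theorem isOpen_paramDomain (m : ℕ) (δ : ℝ) : IsOpen (paramDomain m δ) :=
  isOpen_Ioo.preimage (by fun_prop)

theorem dominatedDerivs_laplaceIntegrand (h₀ : IsPeriodicMetric H₀) (h₁ : IsPeriodicMetric H₁)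
    {δ c : ℝ} (hcpos : 0 < c) (hc : ∀ t ∈ Set.Ioo (-δ) (1 + δ), ∀ μ w : Fin m → ℝ,
      c * ‖w‖ ^ 2 ≤ w ⬝ᵥ interpField H₀ H₁ t μ *ᵥ w) (R : ℝ) (hR : 0 ≤ R) :
    DominatedDerivs volume (paramDomain m δ ∩ Metric.ball 0 R)
      (fun p => Real.exp (-bregmanPhase H₀ H₁ p)) := by
  refine dominatedDerivs_exp_neg volume (bregmanPhase_hasTemperateGrowth h₀ h₁) (c := c / 2) hR
    (fun x hx => ?_) (by positivity) fun x hx w =>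
      bregmanPhase_lower_bound h₀ h₁ (hc _ hx.1) _ _ _
  simpa using (mem_ball_zero_iff.1 hx.2).le

theorem laplaceIntegral_contDiffOn (h₀ : IsPeriodicMetric H₀) (h₁ : IsPeriodicMetric H₁)
    {δ c : ℝ} (hcpos : 0 < c) (hc : ∀ t ∈ Set.Ioo (-δ) (1 + δ), ∀ μ w : Fin m → ℝ,
      c * ‖w‖ ^ 2 ≤ w ⬝ᵥ interpField H₀ H₁ t μ *ᵥ w) :
    ContDiffOn ℝ ∞ (laplaceIntegral H₀ H₁) (paramDomain m δ) := by
  intro x hx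
  have hx' : x ∈ paramDomain m δ ∩ Metric.ball 0 (‖x‖ + 1) := ⟨hx, by simp⟩
  have ho := (isOpen_paramDomain m δ).inter (Metric.isOpen_ball (x := 0) (ε := ‖x‖ + 1))
  exact (((dominatedDerivs_laplaceIntegrand h₀ h₁ hcpos hc (‖x‖ + 1) (by positivity)).contDiffOn
    ho).contDiffAt (ho.mem_nhds hx')).contDiffWithinAt

theorem laplaceIntegral_pos (h₀ : IsPeriodicMetric H₀) (h₁ : IsPeriodicMetric H₁)
    {δ c : ℝ} (hcpos : 0 < c) (hc : ∀ t ∈ Set.Ioo (-δ) (1 + δ), ∀ μ w : Fin m → ℝ,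
      c * ‖w‖ ^ 2 ≤ w ⬝ᵥ interpField H₀ H₁ t μ *ᵥ w)
    {x : (Fin m → ℝ) × ℝ × ℝ} (hx : x ∈ paramDomain m δ) : 0 < laplaceIntegral H₀ H₁ x :=
  integral_exp_pos ((dominatedDerivs_laplaceIntegrand h₀ h₁ hcpos hc (‖x‖ + 1)
    (by positivity)).integrable (x := x) ⟨hx, by simp⟩)

/-- The substitution `w ↦ -w` exchanges `ε` and `-ε`. This removes the half-integer powers of `1/k`
from the expansion. -/
theorem laplaceIntegral_even (μ : Fin m → ℝ) (t ε : ℝ) :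
    laplaceIntegral H₀ H₁ (μ, t, -ε) = laplaceIntegral H₀ H₁ (μ, t, ε) := by
  rw [laplaceIntegral, ← integral_neg_eq_self]
  simp [laplaceIntegral, bregmanPhase, Matrix.mulVec_neg]

theorem laplaceIntegral_periodic (h₀ : IsPeriodicMetric H₀) (h₁ : IsPeriodicMetric H₁)
    (n : Fin m → ℤ) (μ : Fin m → ℝ) (t ε : ℝ) :
    laplaceIntegral H₀ H₁ (μ + fun i => 4 * Real.pi * (n i : ℝ), t, ε) =
      laplaceIntegral H₀ H₁ (μ, t, ε) := by
  have e : ∀ H : (Fin m → ℝ) → Matrix (Fin m) (Fin m) ℝ, IsPeriodicMetric H → ∀ x,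
      H ((μ + fun i => 4 * Real.pi * (n i : ℝ)) + x) = H (μ + x) := fun H hH x => by
    rw [add_right_comm, hH.periodic]
  simp only [laplaceIntegral, bregmanPhase, interpField, e H₀ h₀, e H₁ h₁]

theorem Matrix.PosDef.exists_factorization {A : Matrix (Fin m) (Fin m) ℝ} (hA : A.PosDef) :
    ∃ B : Matrix (Fin m) (Fin m) ℝ, A = Bᵀ * B := by
  open scoped MatrixOrder in
  obtain ⟨B, hB⟩ := CStarAlgebra.nonneg_iff_eq_star_mul_self.mp hA.posSemidef.nonneg
  exact ⟨B, by rw [hB, Matrix.star_eq_conjTranspose, Matrix.conjTranspose_eq_transpose_of_trivial]⟩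

/-- Substitute `Bw` for `w`, where `A = BᵀB` and `|det B|⁻¹ = (det A)^(-1/2)`. The standard Gaussian
integral need not be evaluated, since it cancels in the ratio. -/
theorem integral_exp_neg_posDef {A : Matrix (Fin m) (Fin m) ℝ} (hA : A.PosDef) :
    ∫ w : Fin m → ℝ, Real.exp (-((w ⬝ᵥ A *ᵥ w) / 2)) =
      (∫ w : Fin m → ℝ, Real.exp (-((w ⬝ᵥ w) / 2))) * A.det ^ (-(1 / 2) : ℝ) := by
  obtain ⟨B, hB⟩ := hA.exists_factorization
  have hdet : A.det = B.det ^ 2 := by rw [hB, Matrix.det_mul, Matrix.det_transpose, sq]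
  have hB0 : B.det ≠ 0 := by
    intro h
    have := hA.det_pos
    rw [hdet, h] at this
    simp at this
  have hmap := Real.map_matrix_volume_pi_eq_smul_volume_pi hB0
  have hemb : MeasurableEmbedding (Matrix.toLin' B) := by
    have : Function.Injective (Matrix.toLin' B) :=
      (Matrix.mulVec_injective_iff_isUnit.2 ((Matrix.isUnit_iff_isUnit_det _).2 hB0.isUnit))
    exact (Continuous.measurableEmbedding (LinearMap.continuous_of_finiteDimensional _) this)
  have e := hemb.integral_map (μ := volume)
    (fun w : Fin m → ℝ => Real.exp (-((w ⬝ᵥ w) / 2)))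
  rw [hmap, integral_smul_measure, ENNReal.toReal_ofReal (abs_nonneg _), smul_eq_mul] at e
  have hd : A.det ^ (-(1 / 2) : ℝ) = |B.det⁻¹| := by
    rw [hdet, ← sq_abs, ← Real.rpow_natCast, ← Real.rpow_mul (abs_nonneg _), abs_inv]
    norm_num [Real.rpow_neg_one]
  rw [hd, mul_comm, e]
  congr! 5 with w
  rw [Matrix.toLin'_apply, hB, ← Matrix.mulVec_mulVec, Matrix.dotProduct_mulVec,
    Matrix.vecMul_transpose]

theorem interpField_posDef (h₀ : IsPeriodicMetric H₀) (h₁ : IsPeriodicMetric H₁) {t : ℝ}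
    (ht : t ∈ Set.Icc (0 : ℝ) 1) (μ : Fin m → ℝ) : (interpField H₀ H₁ t μ).PosDef := by
  rcases eq_or_lt_of_le ht.1 with rfl | h
  · simpa [interpField] using h₀.posDef μ
  · exact Matrix.PosDef.posSemidef_add ((h₀.posDef μ).posSemidef.smul (by linarith [ht.2]))
      ((h₁.posDef μ).smul h)

theorem laplaceIntegral_zero (h₀ : IsPeriodicMetric H₀) (h₁ : IsPeriodicMetric H₁) {t : ℝ}
    (ht : t ∈ Set.Icc (0 : ℝ) 1) (μ : Fin m → ℝ) :
    laplaceIntegral H₀ H₁ (μ, t, 0) =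
      (∫ w : Fin m → ℝ, Real.exp (-((w ⬝ᵥ w) / 2))) *
        (interpField H₀ H₁ t μ).det ^ (-(1 / 2) : ℝ) := by
  rw [← integral_exp_neg_posDef (interpField_posDef h₀ h₁ ht μ)]
  simp only [laplaceIntegral, bregmanPhase, mul_zero, zero_smul, add_zero,
    setIntegral_id_mul_const]

/-- This is the case of constant identity metrics at `ε = 0`, where positivity of the Laplace
integral is already known. -/
theorem integral_exp_neg_dotProduct_pos (m : ℕ) :
    0 < ∫ w : Fin m → ℝ, Real.exp (-((w ⬝ᵥ w) / 2)) := by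
  have h : IsPeriodicMetric fun _ : Fin m → ℝ => (1 : Matrix (Fin m) (Fin m) ℝ) :=
    ⟨fun i j => contDiff_const, fun _ _ => rfl, fun _ => Matrix.PosDef.one⟩
  obtain ⟨δ, hδ, c, hc, hb⟩ := h.exists_interpField_lower_bound h
  have := laplaceIntegral_pos h h hc hb (x := (0, 0, 0)) (by simp [paramDomain, hδ]; linarith)
  rw [laplaceIntegral_zero h h (by simp)] at this
  simpa [interpField] using this

/-- The normalised ratio of Laplace integrals, as a function of `(μ, t, ε)`. -/
noncomputable def laplaceRatio (H₀ H₁ : (Fin m → ℝ) → Matrix (Fin m) (Fin m) ℝ)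
    (x : (Fin m → ℝ) × ℝ × ℝ) : ℝ :=
  laplaceIntegral H₀ H₁ x / (laplaceIntegral H₀ H₁ (x.1, 0, x.2.2) ^ (1 - x.2.1) *
    laplaceIntegral H₀ H₁ (x.1, 1, x.2.2) ^ x.2.1)

theorem IsPeriodicMetric.exists_laplaceRatio_contDiffOn (h₀ : IsPeriodicMetric H₀)
    (h₁ : IsPeriodicMetric H₁) :
    ∃ δ > 0, (∀ x ∈ paramDomain m δ, 0 < laplaceRatio H₀ H₁ x) ∧
      ContDiffOn ℝ ∞ (laplaceRatio H₀ H₁) (paramDomain m δ) := by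
  obtain ⟨δ, hδ, c, hc, hb⟩ := h₀.exists_interpField_lower_bound h₁
  have hs := laplaceIntegral_contDiffOn h₀ h₁ hc hb
  have hp : ∀ x ∈ paramDomain m δ, 0 < laplaceIntegral H₀ H₁ x :=
    fun x hx => laplaceIntegral_pos h₀ h₁ hc hb hx
  have m0 : ∀ x : (Fin m → ℝ) × ℝ × ℝ, (x.1, (0 : ℝ), x.2.2) ∈ paramDomain m δ := fun x => by
    simp [paramDomain, hδ]; linarith
  have m1 : ∀ x : (Fin m → ℝ) × ℝ × ℝ, (x.1, (1 : ℝ), x.2.2) ∈ paramDomain m δ := fun x => by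
    simp [paramDomain, hδ]; linarith
  have p0 : ∀ x : (Fin m → ℝ) × ℝ × ℝ, 0 < laplaceIntegral H₀ H₁ (x.1, 0, x.2.2) :=
    fun x => hp _ (m0 x)
  have p1 : ∀ x : (Fin m → ℝ) × ℝ × ℝ, 0 < laplaceIntegral H₀ H₁ (x.1, 1, x.2.2) :=
    fun x => hp _ (m1 x)
  have s0 : ContDiffOn ℝ ∞ (fun x : (Fin m → ℝ) × ℝ × ℝ =>
      laplaceIntegral H₀ H₁ (x.1, 0, x.2.2)) (paramDomain m δ) :=
    hs.comp (by fun_prop) fun x _ => m0 x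
  have s1 : ContDiffOn ℝ ∞ (fun x : (Fin m → ℝ) × ℝ × ℝ =>
      laplaceIntegral H₀ H₁ (x.1, 1, x.2.2)) (paramDomain m δ) :=
    hs.comp (by fun_prop) fun x _ => m1 x
  have den : ∀ x : (Fin m → ℝ) × ℝ × ℝ, 0 < laplaceIntegral H₀ H₁ (x.1, 0, x.2.2) ^ (1 - x.2.1) *
      laplaceIntegral H₀ H₁ (x.1, 1, x.2.2) ^ x.2.1 := fun x =>
    mul_pos (Real.rpow_pos_of_pos (p0 x) _) (Real.rpow_pos_of_pos (p1 x) _)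
  refine ⟨δ, hδ, fun x hx => div_pos (hp x hx) (den x), hs.div (.mul ?_ ?_) fun x _ => (den x).ne'⟩
  · exact s0.rpow (by fun_prop) fun x _ => (p0 x).ne'
  · exact s1.rpow (by fun_prop) fun x _ => (p1 x).ne'

theorem laplaceRatio_even (μ : Fin m → ℝ) (t ε : ℝ) :
    laplaceRatio H₀ H₁ (μ, t, -ε) = laplaceRatio H₀ H₁ (μ, t, ε) := by
  simp only [laplaceRatio, laplaceIntegral_even]

theorem laplaceRatio_periodic (h₀ : IsPeriodicMetric H₀) (h₁ : IsPeriodicMetric H₁)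
    (n : Fin m → ℤ) (μ : Fin m → ℝ) (t ε : ℝ) :
    laplaceRatio H₀ H₁ (μ + fun i => 4 * Real.pi * (n i : ℝ), t, ε) =
      laplaceRatio H₀ H₁ (μ, t, ε) := by
  simp only [laplaceRatio, laplaceIntegral_periodic h₀ h₁]

theorem laplaceRatio_zero (h₀ : IsPeriodicMetric H₀) (h₁ : IsPeriodicMetric H₁) {t : ℝ}
    (ht : t ∈ Set.Icc (0 : ℝ) 1) (μ : Fin m → ℝ) :
    laplaceRatio H₀ H₁ (μ, t, 0) = ((interpField H₀ H₁ t μ).det /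
      ((H₀ μ).det ^ (1 - t) * (H₁ μ).det ^ t)) ^ (-(1 / 2) : ℝ) := by
  have hK := integral_exp_neg_dotProduct_pos m
  have d0 := (h₀.posDef μ).det_pos
  have d1 := (h₁.posDef μ).det_pos
  have dt := (interpField_posDef h₀ h₁ ht μ).det_pos
  have i0 : interpField H₀ H₁ 0 μ = H₀ μ := by simp [interpField]
  have i1 : interpField H₀ H₁ 1 μ = H₁ μ := by simp [interpField]
  simp only [laplaceRatio]
  rw [laplaceIntegral_zero h₀ h₁ ht, laplaceIntegral_zero h₀ h₁ (t := 0) (by simp),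
    laplaceIntegral_zero h₀ h₁ (t := 1) (by simp), i0, i1]
  set K := ∫ w : Fin m → ℝ, Real.exp (-((w ⬝ᵥ w) / 2))
  rw [Real.mul_rpow hK.le (by positivity), Real.mul_rpow hK.le (by positivity),
    Real.div_rpow dt.le (by positivity), Real.mul_rpow (by positivity) (by positivity),
    ← Real.rpow_mul d0.le, ← Real.rpow_mul d0.le, ← Real.rpow_mul d1.le, ← Real.rpow_mul d1.le,
    mul_comm (1 - t), mul_comm t]
  have : K ^ (1 - t) * K ^ t = K := by rw [← Real.rpow_add hK]; simp
  rw [mul_mul_mul_comm, this, mul_div_mul_left _ _ hK.ne']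

end

/-! ### Taylor expansion in even powers of `ε` -/

/-- The derivative in the last variable of a function of `(μ, t, ε)`. -/
noncomputable def epsDeriv {m : ℕ} (G : (Fin m → ℝ) × ℝ × ℝ → ℝ) (x : (Fin m → ℝ) × ℝ × ℝ) : ℝ :=
  fderiv ℝ G x (0, 0, 1)

section

variable {m : ℕ} {δ : ℝ} {G : (Fin m → ℝ) × ℝ × ℝ → ℝ}

theorem epsDeriv_iterate_contDiffOn (hG : ContDiffOn ℝ ∞ G (paramDomain m δ)) (n : ℕ) :
    ContDiffOn ℝ ∞ (epsDeriv^[n] G) (paramDomain m δ) := by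
  induction n generalizing G with
  | zero => exact hG
  | succ n ih =>
    rw [Function.iterate_succ_apply]
    exact ih ((hG.fderiv_of_isOpen (isOpen_paramDomain m δ) (by simp)).clm_apply contDiffOn_const)

/-- Taylor's formula and parity concern the one-variable derivative in `ε`, while `epsDeriv` is
visibly smooth in all of `(μ, t, ε)`; the proof of the expansion needs both descriptions. -/
theorem iteratedDeriv_eq_epsDeriv_iterate (hG : ContDiffOn ℝ ∞ G (paramDomain m δ)) (n : ℕ)
    (μ : Fin m → ℝ) {t : ℝ} (ht : t ∈ Set.Ioo (-δ) (1 + δ)) :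
    iteratedDeriv n (fun ε => G (μ, t, ε)) = fun ε => epsDeriv^[n] G (μ, t, ε) := by
  induction n generalizing G with
  | zero => simp
  | succ n ih =>
    rw [iteratedDeriv_succ', Function.iterate_succ_apply, ← ih (G := epsDeriv G)
      (epsDeriv_iterate_contDiffOn hG 1)]
    congr 1
    ext ε
    have hx : (μ, t, ε) ∈ paramDomain m δ := ht
    have h1 : HasFDerivAt G (fderiv ℝ G (μ, t, ε)) (μ, t, ε) :=
      ((hG.contDiffAt ((isOpen_paramDomain m δ).mem_nhds hx)).differentiableAt
        (by simp)).hasFDerivAt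
    have h2 : HasDerivAt (fun ε : ℝ => (μ, t, ε)) ((0 : Fin m → ℝ), (0 : ℝ), (1 : ℝ)) ε :=
      (hasDerivAt_const ε μ).prodMk ((hasDerivAt_const ε t).prodMk (hasDerivAt_id ε))
    exact (h1.comp_hasDerivAt ε h2).deriv

theorem contDiff_slice (hG : ContDiffOn ℝ ∞ G (paramDomain m δ))
    (μ : Fin m → ℝ) {t : ℝ} (ht : t ∈ Set.Ioo (-δ) (1 + δ)) :
    ContDiff ℝ ∞ fun ε => G (μ, t, ε) := by
  rw [← contDiffOn_univ]
  exact hG.comp (by fun_prop) fun ε _ => ht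

theorem sum_range_eq_sum_even (c : ℕ → ℝ) (hc : ∀ i, Odd i → c i = 0) (ν : ℕ) :
    ∑ k ∈ Finset.range (2 * ν + 2), c k = c 0 + ∑ i ∈ Finset.Icc 1 ν, c (2 * i) := by
  induction ν with
  | zero => simp [Finset.sum_range_succ, hc 1 (by decide)]
  | succ n ih =>
    rw [Finset.sum_Icc_succ_top (by omega), ← add_assoc, ← ih, show 2 * (n + 1) + 2 =
      2 * n + 2 + 1 + 1 by ring, Finset.sum_range_succ, Finset.sum_range_succ,
      hc (2 * n + 2 + 1) ⟨n + 1, by ring⟩, add_zero, show 2 * (n + 1) = 2 * n + 2 by ring]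

theorem iteratedDeriv_zero_of_even {f : ℝ → ℝ} (hf : ∀ ε, f (-ε) = f ε) {i : ℕ} (hi : Odd i) :
    iteratedDeriv i f 0 = 0 := by
  have h := iteratedDeriv_comp_neg i f 0
  rw [funext hf, hi.neg_one_pow, neg_zero, neg_smul, one_smul] at h
  linarith

theorem exists_even_expansion (hδ : 0 < δ) (hG : ContDiffOn ℝ ∞ G (paramDomain m δ))
    (hpos : ∀ x ∈ paramDomain m δ, 0 < G x) (heven : ∀ μ t ε, G (μ, t, -ε) = G (μ, t, ε))
    (hper : ∀ (n : Fin m → ℤ) μ t ε,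
      G (μ + fun i => 4 * Real.pi * (n i : ℝ), t, ε) = G (μ, t, ε)) :
    IsSmoothPeriodicSymbol (fun μ t => G (μ, t, 0)) ∧
    ∃ a : ℕ → (Fin m → ℝ) → ℝ → ℝ, (∀ i, IsSmoothPeriodicSymbol (a i)) ∧
      ∀ ν : ℕ, ∃ C : ℝ, ∀ μ, ∀ t ∈ Set.Icc (0 : ℝ) 1, ∀ ε ∈ Set.Icc (0 : ℝ) 1,
        |G (μ, t, ε) - G (μ, t, 0) * (1 + ∑ i ∈ Finset.Icc 1 ν, a i μ t * (ε ^ 2) ^ i)|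
          ≤ C * (ε ^ 2) ^ (ν + 1) := by
  have hsub : Set.Icc (0 : ℝ) 1 ⊆ Set.Ioo (-δ) (1 + δ) :=
    fun t ht => ⟨by linarith [ht.1], by linarith [ht.2]⟩
  have hiter : ∀ n μ, ∀ t ∈ Set.Icc (0 : ℝ) 1, ∀ ε,
      iteratedDeriv n (fun ε => G (μ, t, ε)) ε = epsDeriv^[n] G (μ, t, ε) := fun n μ t ht ε =>
    congrFun (iteratedDeriv_eq_epsDeriv_iterate hG n μ (hsub ht)) ε
  have hsymb : ∀ n, IsSmoothPeriodicSymbol (fun μ t => epsDeriv^[n] G (μ, t, 0)) := by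
    refine fun n => ⟨?_, fun t ht l μ => ?_⟩
    · exact (epsDeriv_iterate_contDiffOn hG n).comp (t := paramDomain m δ)
        (f := fun p : (Fin m → ℝ) × ℝ => (p.1, p.2, (0 : ℝ))) (by fun_prop) fun p hp => hsub hp.2
    · dsimp only
      rw [← hiter n _ t ht, ← hiter n _ t ht]
      simp only [hper]
  -- The coefficients are the Taylor coefficients of order `2i` divided by the value at `ε = 0`, so
  -- that the limit factors out of the expansion.
  refine ⟨hsymb 0, fun i μ t => epsDeriv^[2 * i] G (μ, t, 0) / (2 * i).factorial / G (μ, t, 0),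
    fun i => ⟨?_, fun t ht l μ => ?_⟩, fun ν => ?_⟩
  · exact ((hsymb (2 * i)).1.div_const _).div (hsymb 0).1 fun p hp => (hpos _ (hsub hp.2)).ne'
  · have e1 := (hsymb (2 * i)).2 t ht l μ
    have e2 := hper l μ t 0
    dsimp only at e1 ⊢
    rw [e1, e2]
  · have hcont : ContinuousOn (fun x => ‖epsDeriv^[2 * ν + 2] G x‖) (paramDomain m δ) :=
      (epsDeriv_iterate_contDiffOn hG _).continuousOn.norm
    have hK : IsCompact (Set.Icc (0 : Fin m → ℝ) (fun _ => 4 * Real.pi) ×ˢ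
      Set.Icc (0 : ℝ) 1 ×ˢ Set.Icc (0 : ℝ) 1) := isCompact_Icc.prod (isCompact_Icc.prod isCompact_Icc)
    obtain ⟨C, hC⟩ := hK.bddAbove_image (hcont.mono fun x hx => hsub hx.2.1)
    -- Translating `μ` into a period cell turns a bound on a compact set into one uniform over all
    -- `μ`, hence over all `k` and `j`.
    have hCb : ∀ μ, ∀ t ∈ Set.Icc (0 : ℝ) 1, ∀ ε ∈ Set.Icc (0 : ℝ) 1,
        ‖iteratedDeriv (2 * ν + 2) (fun ε => G (μ, t, ε)) ε‖ ≤ C := by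
      intro μ t ht ε hε
      obtain ⟨n, hn⟩ := exists_add_mem_Icc (c := 4 * Real.pi) (by positivity) μ
      have : (fun ε => G (μ, t, ε)) =
        fun ε => G (μ + fun i => 4 * Real.pi * (n i : ℝ), t, ε) := by simp only [hper]
      rw [this, hiter _ _ t ht]
      exact hC ⟨_, ⟨hn, ht, hε⟩, rfl⟩
    refine ⟨C / (2 * ν + 1).factorial, fun μ t ht ε hε => ?_⟩
    have hf := contDiff_slice hG μ (hsub ht)
    have hw : ∀ k, ∀ y ∈ Set.Icc (0 : ℝ) 1,
        iteratedDerivWithin k (fun ε => G (μ, t, ε)) (Set.Icc 0 1) y =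
          iteratedDeriv k (fun ε => G (μ, t, ε)) y := fun k y hy =>
      iteratedDerivWithin_eq_iteratedDeriv (uniqueDiffOn_Icc one_pos)
        ((hf.of_le (by exact_mod_cast le_top)).contDiffAt) hy
    -- The order is `2ν + 1` rather than `2ν`: the top coefficient is odd and vanishes, and the
    -- remainder is of size `ε ^ (2ν + 2)`, the required `k ^ (-ν - 1)`.
    have hT := taylor_mean_remainder_bound (f := fun ε => G (μ, t, ε)) (n := 2 * ν + 1)
      zero_le_one (by exact_mod_cast (contDiff_infty.1 hf (2 * ν + 1 + 1)).contDiffOn) hε (C := C)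
      (fun y hy => by rw [hw _ y hy]; exact hCb μ t ht y hy)
    rw [taylor_within_apply, sum_range_eq_sum_even] at hT
    · have h0 := (hpos (μ, t, 0) (hsub ht)).ne'
      refine le_trans (le_of_eq ?_) (hT.trans (le_of_eq ?_))
      · rw [Real.norm_eq_abs]
        congr 2
        rw [mul_add, mul_one, Finset.mul_sum]
        congr 1
        · simp
        · refine Finset.sum_congr rfl fun i _ => ?_
          rw [hw _ 0 (by simp), hiter _ _ t ht, sub_zero, smul_eq_mul, ← pow_mul]
          field_simp
      · rw [sub_zero, ← pow_mul]
        ring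
    · intro i hi
      rw [hw _ 0 (by simp), iteratedDeriv_zero_of_even (heven μ t) hi, smul_zero]

end

/-! ### The gradient map and Legendre transform of a uniformly convex function -/

/-- The local inverse given by the inverse function theorem tends to `a`, so near `f a` it takes
values where `g` inverts `f`; there the two functions agree. -/
theorem contDiffAt_of_eventually_leftInverse {E : Type} [NormedAddCommGroup E] [NormedSpace ℝ E]
    [FiniteDimensional ℝ E] {f g : E → E} {a : E} (hf : ContDiffAt ℝ ∞ f a)
    (hinj : ∀ v, fderiv ℝ f a v = 0 → v = 0) (hg : ∀ᶠ x in 𝓝 a, g (f x) = x) :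
    ContDiffAt ℝ ∞ g (f a) := by
  have : CompleteSpace E := FiniteDimensional.complete ℝ E
  let e : E ≃L[ℝ] E := (LinearEquiv.ofInjectiveEndo (fderiv ℝ f a : E →ₗ[ℝ] E)
    (LinearMap.ker_eq_bot.1 ((LinearMap.ker_eq_bot').2 hinj))).toContinuousLinearEquiv
  have he : HasFDerivAt f (e : E →L[ℝ] E) a := by
    have h1 : (e : E →L[ℝ] E) = fderiv ℝ f a := by ext v; rfl
    rw [h1]
    exact (hf.differentiableAt (by simp)).hasFDerivAt
  have hs := hf.hasStrictFDerivAt' he (by simp)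
  refine (hf.to_localInverse he (by simp)).congr_of_eventuallyEq ?_
  have h1 : ∀ᶠ y in 𝓝 (f a), f (hf.localInverse he (by simp) y) = y := hs.eventually_right_inverse
  have h2 : Tendsto (hf.localInverse he (by simp)) (𝓝 (f a)) (𝓝 a) := hs.localInverse_tendsto
  filter_upwards [h1, h2.eventually hg] with y hy1 hy2
  rw [hy1] at hy2
  exact hy2

/-- The gradient of a real function on `ℝ^m`. -/
noncomputable def coordGradient {m : ℕ} (f : (Fin m → ℝ) → ℝ) (y : Fin m → ℝ) : Fin m → ℝ :=
  fun i => partialDeriv f i y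

section

variable {m : ℕ}

theorem clm_apply_eq_dotProduct (L : (Fin m → ℝ) →L[ℝ] ℝ) (w : Fin m → ℝ) :
    L w = w ⬝ᵥ fun i => L (Pi.single i 1) := by
  conv_lhs => rw [pi_eq_sum_univ' w]
  simp only [map_sum, map_smul, smul_eq_mul, dotProduct]

theorem fderiv_apply_eq_dotProduct (f : (Fin m → ℝ) → ℝ) (y w : Fin m → ℝ) :
    fderiv ℝ f y w = w ⬝ᵥ coordGradient f y :=
  clm_apply_eq_dotProduct _ _

theorem contDiff_partialDeriv {f : (Fin m → ℝ) → ℝ} (hf : ContDiff ℝ ∞ f) (i : Fin m) :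
    ContDiff ℝ ∞ (partialDeriv f i) :=
  (hf.fderiv_right (m := ∞) (by simp)).clm_apply contDiff_const

theorem contDiff_gradient {f : (Fin m → ℝ) → ℝ} (hf : ContDiff ℝ ∞ f) :
    ContDiff ℝ ∞ (coordGradient f) :=
  contDiff_pi.2 fun i => contDiff_partialDeriv hf i

theorem contDiff_hess {f : (Fin m → ℝ) → ℝ} (hf : ContDiff ℝ ∞ f) (i j : Fin m) :
    ContDiff ℝ ∞ fun y => hess f y i j :=
  contDiff_partialDeriv (contDiff_partialDeriv hf j) i

theorem fderiv_gradient_apply {f : (Fin m → ℝ) → ℝ} (hf : ContDiff ℝ ∞ f) (y w : Fin m → ℝ) :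
    fderiv ℝ (coordGradient f) y w = w ᵥ* hess f y := by
  have h : ∀ j, DifferentiableAt ℝ (partialDeriv f j) y := fun j =>
    (contDiff_partialDeriv hf j).differentiable (by simp) y
  ext j
  have : fderiv ℝ (coordGradient f) y = ContinuousLinearMap.pi fun j => fderiv ℝ (partialDeriv f j) y :=
    fderiv_pi h
  rw [this, ContinuousLinearMap.pi_apply, clm_apply_eq_dotProduct]
  rfl

theorem hasDerivAt_line (y v : Fin m → ℝ) (s : ℝ) :
    HasDerivAt (fun s : ℝ => y + s • v) v s := by
  simpa using ((hasDerivAt_id s).smul_const v).const_add y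

theorem hasDerivAt_comp_line {φ : (Fin m → ℝ) → ℝ} (h : ContDiff ℝ ∞ φ) (y v : Fin m → ℝ) (s : ℝ) :
    HasDerivAt (fun s : ℝ => φ (y + s • v)) (v ⬝ᵥ coordGradient φ (y + s • v)) s := by
  have h1 := (h.differentiable (by simp) (y + s • v)).hasFDerivAt.comp_hasDerivAt s
    (hasDerivAt_line y v s)
  rwa [fderiv_apply_eq_dotProduct] at h1

theorem hasDerivAt_gradient_line {φ : (Fin m → ℝ) → ℝ} (h : ContDiff ℝ ∞ φ) (y v : Fin m → ℝ) (s : ℝ) :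
    HasDerivAt (fun s : ℝ => v ⬝ᵥ coordGradient φ (y + s • v))
      (v ⬝ᵥ hess φ (y + s • v) *ᵥ v) s := by
  have h1 := ((contDiff_gradient h).differentiable (by simp)
    (y + s • v)).hasFDerivAt.comp_hasDerivAt s (hasDerivAt_line y v s)
  rw [fderiv_gradient_apply h] at h1
  have h2 : HasDerivAt (fun s : ℝ => ∑ i, v i * coordGradient φ (y + s • v) i)
      (∑ i, v i * (v ᵥ* hess φ (y + s • v)) i) s :=
    HasDerivAt.fun_sum fun i _ => ((hasDerivAt_pi.1 h1) i).const_mul (v i)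
  rw [Matrix.dotProduct_mulVec, dotProduct_comm]
  exact h2

/-- A smooth function whose Hessian is positive definite, uniformly on `ℝ^m`. -/
structure IsUniformlyConvex (φ : (Fin m → ℝ) → ℝ) (c : ℝ) : Prop where
  smooth : ContDiff ℝ ∞ φ
  pos : 0 < c
  le_hess : ∀ y w, c * ‖w‖ ^ 2 ≤ w ⬝ᵥ hess φ y *ᵥ w
  posDef : ∀ y, (hess φ y).PosDef

namespace IsUniformlyConvex

variable {φ : (Fin m → ℝ) → ℝ} {c : ℝ} (h : IsUniformlyConvex φ c)
include h

theorem gradient_monotone (y v : Fin m → ℝ) {s : ℝ} (hs : 0 ≤ s) :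
    v ⬝ᵥ coordGradient φ y + c * s * ‖v‖ ^ 2 ≤ v ⬝ᵥ coordGradient φ (y + s • v) := by
  have hd : ∀ s : ℝ, HasDerivAt (fun s : ℝ => v ⬝ᵥ coordGradient φ (y + s • v) - c * s * ‖v‖ ^ 2)
      (v ⬝ᵥ hess φ (y + s • v) *ᵥ v - c * 1 * ‖v‖ ^ 2) s := fun s =>
    (hasDerivAt_gradient_line h.smooth y v s).sub (((hasDerivAt_id s).const_mul c).mul_const _)
  have hm := monotone_of_deriv_nonneg (fun s => (hd s).differentiableAt) (fun s => by
    rw [(hd s).deriv]; linarith [h.le_hess (y + s • v) v])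
  have := hm hs
  simp only [zero_smul, add_zero, mul_zero, zero_mul, sub_zero] at this
  linarith

theorem add_le (y v : Fin m → ℝ) :
    φ y + v ⬝ᵥ coordGradient φ y + c / 2 * ‖v‖ ^ 2 ≤ φ (y + v) := by
  have hd : ∀ s : ℝ, HasDerivAt (fun s : ℝ => φ (y + s • v) - s * (v ⬝ᵥ coordGradient φ y) -
      c / 2 * ‖v‖ ^ 2 * s ^ 2) (v ⬝ᵥ coordGradient φ (y + s • v) - 1 * (v ⬝ᵥ coordGradient φ y) -
      c / 2 * ‖v‖ ^ 2 * ((2 : ℕ) * s ^ (2 - 1))) s := fun s =>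
    ((hasDerivAt_comp_line h.smooth y v s).sub ((hasDerivAt_id s).mul_const _)).sub
      ((hasDerivAt_pow 2 s).const_mul _)
  have hm : MonotoneOn (fun s : ℝ => φ (y + s • v) - s * (v ⬝ᵥ coordGradient φ y) -
      c / 2 * ‖v‖ ^ 2 * s ^ 2) (Set.Icc 0 1) := by
    refine monotoneOn_of_deriv_nonneg (convex_Icc 0 1)
      (fun s _ => (hd s).continuousAt.continuousWithinAt)
      (fun s _ => (hd s).differentiableAt.differentiableWithinAt) fun s hs => ?_
    rw [interior_Icc] at hs
    rw [(hd s).deriv]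
    have := h.gradient_monotone y v hs.1.le
    norm_num
    linarith
  have := hm (Set.left_mem_Icc.2 zero_le_one) (Set.right_mem_Icc.2 zero_le_one) zero_le_one
  simp only [zero_smul, add_zero, one_smul] at this
  linarith

theorem gradient_injective : Function.Injective (coordGradient φ) := by
  intro y z hyz
  have h1 := h.gradient_monotone y (z - y) zero_le_one
  rw [one_smul, add_sub_cancel, ← hyz] at h1
  have h2 : c * ‖z - y‖ ^ 2 ≤ 0 := by linarith
  have h3 : ‖z - y‖ ^ 2 ≤ 0 := by
    by_contra! h4
    linarith [mul_pos h.pos h4]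
  have : ‖z - y‖ = 0 := by nlinarith [norm_nonneg (z - y)]
  exact (sub_eq_zero.1 (norm_eq_zero.1 this)).symm

/-- A minimiser of `φ(y) - y·μ` is a critical point, where `∇φ = μ`. It exists because quadratic
growth beats the linear term. -/
theorem gradient_surjective : Function.Surjective (coordGradient φ) := by
  intro μ
  set a := coordGradient φ 0 - μ with ha
  set K := ∑ i, |a i| with hK
  have hb : ∀ v : Fin m → ℝ, -(K * ‖v‖) ≤ v ⬝ᵥ a := by
    intro v
    rw [hK, Finset.sum_mul, ← Finset.sum_neg_distrib, dotProduct]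
    refine Finset.sum_le_sum fun i _ => ?_
    have h1 : |v i| ≤ ‖v‖ := norm_le_pi_norm v i
    have h2 : |v i * a i| ≤ |a i| * ‖v‖ := by rw [abs_mul, mul_comm]; gcongr
    exact (abs_le.1 h2).1
  have hcont : Continuous fun y => φ y - y ⬝ᵥ μ :=
    h.smooth.continuous.sub (continuous_id.dotProduct continuous_const)
  obtain ⟨y, hy⟩ := hcont.exists_forall_le' 0 (by
    -- Beyond `‖v‖ = 2K/c` the quadratic gain `(c/2)‖v‖²` exceeds the linear loss `K‖v‖`.
    filter_upwards [(tendsto_norm_cocompact_atTop (E := Fin m → ℝ)).eventually_ge_atTop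
      (2 * K / c)] with v hv
    have h1 := h.add_le 0 v
    rw [zero_add] at h1
    have h2 := hb v
    rw [ha, dotProduct_sub] at h2
    have h3 : K * ‖v‖ ≤ c / 2 * ‖v‖ ^ 2 := by
      rw [div_le_iff₀ h.pos] at hv
      nlinarith [norm_nonneg v]
    rw [zero_dotProduct]
    linarith)
  refine ⟨y, ?_⟩
  have hmin : IsLocalMin (fun y => φ y - y ⬝ᵥ μ) y := Eventually.of_forall hy
  have hlin : HasFDerivAt (fun y : Fin m → ℝ => y ⬝ᵥ μ)
      (∑ i, μ i • ContinuousLinearMap.proj (R := ℝ) (φ := fun _ : Fin m => ℝ) i) y := by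
    simp only [dotProduct]
    exact HasFDerivAt.fun_sum fun i _ => (hasFDerivAt_apply (𝕜 := ℝ) i y).mul_const (μ i)
  have hd := (h.smooth.differentiable (by simp) y).hasFDerivAt.sub hlin
  have h0 := hmin.hasFDerivAt_eq_zero hd
  ext i
  have h1 := congrArg (fun L : (Fin m → ℝ) →L[ℝ] ℝ => L (Pi.single i 1)) h0
  simp [Pi.single_apply, sub_eq_zero] at h1
  exact h1

end IsUniformlyConvex

/-- The inverse of the gradient map. -/
noncomputable def gradientInv (φ : (Fin m → ℝ) → ℝ) : (Fin m → ℝ) → (Fin m → ℝ) :=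
  Function.invFun (coordGradient φ)

namespace IsUniformlyConvex

variable {φ : (Fin m → ℝ) → ℝ} {c : ℝ} (h : IsUniformlyConvex φ c)
include h

theorem gradientInv_gradient (y : Fin m → ℝ) : gradientInv φ (coordGradient φ y) = y :=
  Function.leftInverse_invFun h.gradient_injective y

theorem gradient_gradientInv (μ : Fin m → ℝ) : coordGradient φ (gradientInv φ μ) = μ :=
  Function.rightInverse_invFun h.gradient_surjective μ

theorem sub_le (μ y : Fin m → ℝ) :
    μ ⬝ᵥ y - φ y ≤ μ ⬝ᵥ gradientInv φ μ - φ (gradientInv φ μ) := by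
  have h1 := h.add_le (gradientInv φ μ) (y - gradientInv φ μ)
  rw [add_sub_cancel, h.gradient_gradientInv, sub_dotProduct, dotProduct_comm y,
    dotProduct_comm (gradientInv φ μ)] at h1
  have h2 : 0 ≤ c / 2 * ‖y - gradientInv φ μ‖ ^ 2 := by have := h.pos; positivity
  linarith

theorem legendre_eq (μ : Fin m → ℝ) :
    legendre φ μ = μ ⬝ᵥ gradientInv φ μ - φ (gradientInv φ μ) := by
  refine IsGreatest.csSup_eq ⟨⟨gradientInv φ μ, rfl⟩, ?_⟩
  rintro _ ⟨y, rfl⟩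
  exact h.sub_le μ y

theorem le_legendre (μ y : Fin m → ℝ) : μ ⬝ᵥ y - φ y ≤ legendre φ μ :=
  (h.sub_le μ y).trans_eq (h.legendre_eq μ).symm

theorem vecMul_hess_eq_zero {y w : Fin m → ℝ} (hw : w ᵥ* hess φ y = 0) : w = 0 := by
  have h1 := h.le_hess y w
  rw [Matrix.dotProduct_mulVec, hw, zero_dotProduct] at h1
  have h3 : ‖w‖ ^ 2 ≤ 0 := by
    by_contra! h4
    linarith [mul_pos h.pos h4]
  exact norm_eq_zero.1 (by nlinarith [norm_nonneg w])

theorem contDiff_gradientInv : ContDiff ℝ ∞ (gradientInv φ) := by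
  refine contDiff_iff_contDiffAt.2 fun μ => ?_
  rw [← h.gradient_gradientInv μ]
  refine contDiffAt_of_eventually_leftInverse (contDiff_gradient h.smooth).contDiffAt
    (fun v hv => ?_) (Eventually.of_forall h.gradientInv_gradient)
  rw [fderiv_gradient_apply h.smooth] at hv
  exact h.vecMul_hess_eq_zero hv

theorem vecMul_fderiv_gradientInv (μ w : Fin m → ℝ) :
    (fderiv ℝ (gradientInv φ) μ w) ᵥ* hess φ (gradientInv φ μ) = w := by
  rw [← fderiv_gradient_apply h.smooth]
  have h1 : HasFDerivAt (coordGradient φ ∘ gradientInv φ) _ μ :=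
    ((contDiff_gradient h.smooth).differentiable (by simp) _).hasFDerivAt.comp μ
    (h.contDiff_gradientInv.differentiable (by simp) μ).hasFDerivAt
  have h2 : coordGradient φ ∘ gradientInv φ = id := funext h.gradient_gradientInv
  rw [h2] at h1
  have := h1.unique (hasFDerivAt_id μ)
  exact congrArg (fun L : (Fin m → ℝ) →L[ℝ] (Fin m → ℝ) => L w) this

theorem contDiff_legendre : ContDiff ℝ ∞ (legendre φ) := by
  rw [funext h.legendre_eq]
  have := contDiff_pi.1 h.contDiff_gradientInv
  refine ContDiff.sub ?_ (h.smooth.comp h.contDiff_gradientInv)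
  simp only [dotProduct]
  fun_prop

/-- Envelope principle: differentiating `μ·Y(μ) - φ(Y(μ))` along `w`, the two terms containing the
derivative of `Y` cancel because `∇φ(Y(μ)) = μ`. -/
theorem fderiv_legendre_apply (μ : Fin m → ℝ) (w : Fin m → ℝ) :
    fderiv ℝ (legendre φ) μ w = w ⬝ᵥ gradientInv φ μ := by
  have hl : HasDerivAt (fun s : ℝ => legendre φ (μ + s • w)) (fderiv ℝ (legendre φ) μ w) 0 := by
    have h1 := (h.contDiff_legendre.differentiable (by simp) (μ + (0 : ℝ) • w)).hasFDerivAt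
    have h2 := h1.comp_hasDerivAt 0 (hasDerivAt_line μ w 0)
    simpa [Function.comp_def] using h2
  have hYl : HasDerivAt (fun s : ℝ => gradientInv φ (μ + s • w))
      (fderiv ℝ (gradientInv φ) μ w) 0 := by
    have h1 := (h.contDiff_gradientInv.differentiable (by simp) (μ + (0 : ℝ) • w)).hasFDerivAt
    have h2 := h1.comp_hasDerivAt 0 (hasDerivAt_line μ w 0)
    simpa [Function.comp_def] using h2
  have hφl : HasDerivAt (fun s : ℝ => φ (gradientInv φ (μ + s • w)))
      ((fderiv ℝ (gradientInv φ) μ w) ⬝ᵥ μ) 0 := by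
    have h1 := (h.smooth.differentiable (by simp)
      (gradientInv φ (μ + (0 : ℝ) • w))).hasFDerivAt
    have h2 := h1.comp_hasDerivAt 0 hYl
    rw [fderiv_apply_eq_dotProduct, h.gradient_gradientInv] at h2
    simpa [Function.comp_def] using h2
  have hdot : HasDerivAt (fun s : ℝ => ∑ i, (μ + s • w) i * gradientInv φ (μ + s • w) i)
      (∑ i, (w i * gradientInv φ (μ + (0 : ℝ) • w) i +
        (μ + (0 : ℝ) • w) i * (fderiv ℝ (gradientInv φ) μ w) i)) 0 :=
    HasDerivAt.fun_sum fun i _ =>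
      (hasDerivAt_pi.1 (hasDerivAt_line μ w 0) i).mul (hasDerivAt_pi.1 hYl i)
  have h3 := hdot.sub hφl
  have h4 : (fun s : ℝ => legendre φ (μ + s • w)) =
      fun s : ℝ => ∑ i, (μ + s • w) i * gradientInv φ (μ + s • w) i -
        φ (gradientInv φ (μ + s • w)) := funext fun s => h.legendre_eq _
  rw [h4] at hl
  rw [hl.unique h3, zero_smul, add_zero, Finset.sum_add_distrib]
  simp only [dotProduct, mul_comm]
  ring

theorem gradient_legendre : coordGradient (legendre φ) = gradientInv φ := by
  ext μ i
  have := h.fderiv_legendre_apply μ (Pi.single i 1)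
  rw [single_one_dotProduct] at this
  exact this

theorem hess_legendre_mul (μ : Fin m → ℝ) :
    hess (legendre φ) μ * hess φ (gradientInv φ μ) = 1 := by
  have key : ∀ w, w ᵥ* (hess (legendre φ) μ * hess φ (gradientInv φ μ)) = w := by
    intro w
    rw [← Matrix.vecMul_vecMul, ← fderiv_gradient_apply h.contDiff_legendre, h.gradient_legendre,
      h.vecMul_fderiv_gradientInv]
  ext i j
  have := congrFun (key (Pi.single i 1)) j
  rw [Matrix.single_one_vecMul] at this
  simpa [Pi.single_apply, Matrix.one_apply, eq_comm] using this

theorem hess_legendre (μ : Fin m → ℝ) :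
    hess (legendre φ) μ = (hess φ (gradientInv φ μ))⁻¹ :=
  (Matrix.inv_eq_left_inv (h.hess_legendre_mul μ)).symm

theorem posDef_hess_legendre (μ : Fin m → ℝ) : (hess (legendre φ) μ).PosDef := by
  rw [h.hess_legendre]
  exact (h.posDef _).inv

end IsUniformlyConvex

end

/-! ### Invariant Kähler potentials -/

section

variable {m : ℕ}

theorem partialDeriv_linear_comb {f g : (Fin m → ℝ) → ℝ} {y : Fin m → ℝ} (a b : ℝ)
    (hf : DifferentiableAt ℝ f y) (hg : DifferentiableAt ℝ g y) (i : Fin m) :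
    partialDeriv (fun y => a * f y + b * g y) i y =
      a * partialDeriv f i y + b * partialDeriv g i y := by
  have h := (hf.hasFDerivAt.const_mul a).add (hg.hasFDerivAt.const_mul b)
  simp only [partialDeriv]
  erw [h.fderiv]
  simp

theorem hess_linear_comb {f g : (Fin m → ℝ) → ℝ} (a b : ℝ) (hf : ContDiff ℝ ∞ f)
    (hg : ContDiff ℝ ∞ g) (y : Fin m → ℝ) :
    hess (fun y => a * f y + b * g y) y = a • hess f y + b • hess g y := by
  ext i j
  have h1 : partialDeriv (fun y => a * f y + b * g y) j =
      fun y => a * partialDeriv f j y + b * partialDeriv g j y := funext fun y =>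
    partialDeriv_linear_comb a b (hf.differentiable (by simp) y) (hg.differentiable (by simp) y) j
  simp only [hess, Matrix.of_apply, Matrix.add_apply, Matrix.smul_apply, smul_eq_mul, h1]
  exact partialDeriv_linear_comb a b ((contDiff_partialDeriv hf j).differentiable (by simp) y)
    ((contDiff_partialDeriv hg j).differentiable (by simp) y) i

theorem gradient_linear_comb {f g : (Fin m → ℝ) → ℝ} (a b : ℝ) (hf : ContDiff ℝ ∞ f)
    (hg : ContDiff ℝ ∞ g) (y : Fin m → ℝ) :
    coordGradient (fun y => a * f y + b * g y) y = a • coordGradient f y + b • coordGradient g y := by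
  ext i
  exact partialDeriv_linear_comb a b (hf.differentiable (by simp) y)
    (hg.differentiable (by simp) y) i

theorem contDiff_dotProduct_self : ContDiff ℝ ∞ fun y : Fin m → ℝ => y ⬝ᵥ y := by
  simp only [dotProduct]
  fun_prop

theorem gradient_dotProduct_self (y : Fin m → ℝ) :
    coordGradient (fun y : Fin m → ℝ => y ⬝ᵥ y) y = (2 : ℝ) • y := by
  have hd : HasFDerivAt (fun y : Fin m → ℝ => ∑ i, y i * y i)
      (∑ i, (y i • ContinuousLinearMap.proj (R := ℝ) (φ := fun _ : Fin m => ℝ) i +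
        y i • ContinuousLinearMap.proj (R := ℝ) (φ := fun _ : Fin m => ℝ) i)) y :=
    HasFDerivAt.fun_sum fun i _ => (hasFDerivAt_apply (𝕜 := ℝ) i y).mul
      (hasFDerivAt_apply (𝕜 := ℝ) i y)
  ext j
  simp only [coordGradient, partialDeriv, dotProduct]
  rw [hd.fderiv]
  simp [Pi.single_apply, Finset.sum_add_distrib, two_mul]

theorem hess_dotProduct_self (y : Fin m → ℝ) :
    hess (fun y : Fin m → ℝ => y ⬝ᵥ y) y = (2 : ℝ) • (1 : Matrix (Fin m) (Fin m) ℝ) := by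
  ext i j
  have h1 : partialDeriv (fun y : Fin m → ℝ => y ⬝ᵥ y) j = fun y => 2 * y j := funext fun y =>
    congrFun (gradient_dotProduct_self y) j
  have hd : HasFDerivAt (fun y : Fin m → ℝ => 2 * y j)
      ((2 : ℝ) • ContinuousLinearMap.proj (R := ℝ) (φ := fun _ : Fin m => ℝ) j) y :=
    (hasFDerivAt_apply (𝕜 := ℝ) j y).const_mul 2
  simp only [hess, Matrix.of_apply, h1, partialDeriv]
  rw [hd.fderiv]
  simp [Pi.single_apply, Matrix.one_apply, eq_comm]

theorem partialDeriv_add_right {f : (Fin m → ℝ) → ℝ} {v : Fin m → ℝ}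
    (hf : ∀ y, f (y + v) = f y) (i : Fin m) (y : Fin m → ℝ) :
    partialDeriv f i (y + v) = partialDeriv f i y := by
  have : fderiv ℝ (fun y => f (y + v)) y = fderiv ℝ f (y + v) := fderiv_comp_add_right v
  rw [partialDeriv, ← this, funext hf, partialDeriv]

namespace IsInvariantPotential

variable {ψ : (Fin m → ℝ) → ℝ} (h : IsInvariantPotential ψ)
include h

theorem contDiff_kahlerPotential : ContDiff ℝ ∞ (kahlerPotential ψ) :=
  (contDiff_const.mul contDiff_dotProduct_self).add (contDiff_const.mul h.smooth)

theorem hess_kahlerPotential (y : Fin m → ℝ) :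
    hess (kahlerPotential ψ) y = (4 * Real.pi) • (1 + hess ψ y) := by
  have := hess_linear_comb (2 * Real.pi) (4 * Real.pi) contDiff_dotProduct_self h.smooth y
  rw [hess_dotProduct_self, smul_smul, show 2 * Real.pi * 2 = 4 * Real.pi by ring,
    ← smul_add] at this
  exact this

theorem gradient_kahlerPotential (y : Fin m → ℝ) :
    coordGradient (kahlerPotential ψ) y = (4 * Real.pi) • (y + coordGradient ψ y) := by
  have := gradient_linear_comb (2 * Real.pi) (4 * Real.pi) contDiff_dotProduct_self h.smooth y
  rw [gradient_dotProduct_self, smul_smul, show 2 * Real.pi * 2 = 4 * Real.pi by ring,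
    ← smul_add] at this
  exact this

theorem partialDeriv_periodic (n : Fin m → ℤ) (i : Fin m) (y : Fin m → ℝ) :
    partialDeriv ψ i (y + fun i => (n i : ℝ)) = partialDeriv ψ i y :=
  partialDeriv_add_right (fun y => by simpa using h.periodic n y) i y

theorem hess_periodic (n : Fin m → ℤ) (y : Fin m → ℝ) :
    hess ψ (y + fun i => (n i : ℝ)) = hess ψ y := by
  ext i j
  exact partialDeriv_add_right (fun y => h.partialDeriv_periodic n j y) i y

/-- The quadratic part of `φ` makes the gradient map equivariant from the lattice `ℤ^m` to `4πℤ^m`.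
This is the origin of the period `4π` in `μ`: the Legendre transform itself need not be periodic,
but its Hessian is. -/
theorem gradient_kahlerPotential_add (n : Fin m → ℤ) (y : Fin m → ℝ) :
    coordGradient (kahlerPotential ψ) (y + fun i => (n i : ℝ)) =
      coordGradient (kahlerPotential ψ) y + fun i => 4 * Real.pi * (n i : ℝ) := by
  rw [h.gradient_kahlerPotential, h.gradient_kahlerPotential]
  ext i
  have := h.partialDeriv_periodic n i y
  simp only [Pi.smul_apply, Pi.add_apply, coordGradient, smul_eq_mul, this]
  ring

theorem posDef_hess_kahlerPotential (y : Fin m → ℝ) : (hess (kahlerPotential ψ) y).PosDef := by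
  rw [h.hess_kahlerPotential]
  exact (h.posDef y).smul (by positivity)

theorem exists_isUniformlyConvex : ∃ c, IsUniformlyConvex (kahlerPotential ψ) c := by
  obtain ⟨c, hc, hb⟩ := exists_quadratic_lower_bound (c := 1) one_pos
    (A := hess (kahlerPotential ψ))
    (continuous_matrix fun i j => (contDiff_hess h.contDiff_kahlerPotential i j).continuous)
    (fun n y => by
      simp only [one_mul, h.hess_kahlerPotential, h.hess_periodic])
    (fun y w hw => by simpa using (h.posDef_hess_kahlerPotential y).dotProduct_mulVec_pos hw)
  exact ⟨c, h.contDiff_kahlerPotential, hc, hb, h.posDef_hess_kahlerPotential⟩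

theorem gradientInv_add (n : Fin m → ℤ) (μ : Fin m → ℝ) :
    gradientInv (kahlerPotential ψ) (μ + fun i => 4 * Real.pi * (n i : ℝ)) =
      gradientInv (kahlerPotential ψ) μ + fun i => (n i : ℝ) := by
  obtain ⟨c, hc⟩ := h.exists_isUniformlyConvex
  apply hc.gradient_injective
  rw [hc.gradient_gradientInv, h.gradient_kahlerPotential_add, hc.gradient_gradientInv]

theorem isPeriodicMetric : IsPeriodicMetric (hess (legendre (kahlerPotential ψ))) := by
  obtain ⟨c, hc⟩ := h.exists_isUniformlyConvex
  refine ⟨fun i j => contDiff_hess hc.contDiff_legendre i j, fun n μ => ?_,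
    hc.posDef_hess_legendre⟩
  rw [hc.hess_legendre, hc.hess_legendre, h.gradientInv_add, h.hess_kahlerPotential,
    h.hess_periodic, ← h.hess_kahlerPotential]

end IsInvariantPotential

end

/-! ### Geodesics become affine under the Legendre transform -/

namespace IsSmoothGeodesic

variable {m : ℕ} {ψ : ℝ → (Fin m → ℝ) → ℝ} (h : IsSmoothGeodesic ψ)
include h

theorem contDiffAt_potential {t : ℝ} (ht : t ∈ Set.Ioo (0 : ℝ) 1) (y : Fin m → ℝ) :
    ContDiffAt ℝ ∞ (fun p : ℝ × (Fin m → ℝ) => kahlerPotential (ψ p.1) p.2) (t, y) := by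
  have h1 : ContDiffAt ℝ ∞ (fun p : ℝ × (Fin m → ℝ) => ψ p.1 p.2) (t, y) :=
    h.smooth.contDiffAt (prod_mem_nhds (Icc_mem_nhds ht.1 ht.2) univ_mem)
  exact (contDiffAt_const.mul (contDiff_dotProduct_self.contDiffAt.comp (t, y)
    contDiffAt_snd)).add (contDiffAt_const.mul h1)

theorem hasFDerivAt_potential {t : ℝ} (ht : t ∈ Set.Ioo (0 : ℝ) 1) (y : Fin m → ℝ) :
    HasFDerivAt (fun p : ℝ × (Fin m → ℝ) => kahlerPotential (ψ p.1) p.2)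
      (fderiv ℝ (fun p : ℝ × (Fin m → ℝ) => kahlerPotential (ψ p.1) p.2) (t, y)) (t, y) :=
  ((h.contDiffAt_potential ht y).differentiableAt (by simp)).hasFDerivAt

theorem contDiffAt_fderiv_apply {t : ℝ} (ht : t ∈ Set.Ioo (0 : ℝ) 1) (y : Fin m → ℝ)
    (v : ℝ × (Fin m → ℝ)) :
    ContDiffAt ℝ ∞ (fun p : ℝ × (Fin m → ℝ) =>
      fderiv ℝ (fun p : ℝ × (Fin m → ℝ) => kahlerPotential (ψ p.1) p.2) p v) (t, y) :=
  ((h.contDiffAt_potential ht y).fderiv_right (m := ∞) (by simp)).clm_apply contDiffAt_const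

theorem fderiv_potential_snd {t : ℝ} (ht : t ∈ Set.Ioo (0 : ℝ) 1) (y v : Fin m → ℝ) :
    fderiv ℝ (fun p : ℝ × (Fin m → ℝ) => kahlerPotential (ψ p.1) p.2) (t, y) (0, v) =
      v ⬝ᵥ coordGradient (kahlerPotential (ψ t)) y := by
  have h1 := (h.hasFDerivAt_potential ht y).comp y (hasFDerivAt_prodMk_right t y)
  rw [← fderiv_apply_eq_dotProduct, show kahlerPotential (ψ t) =
    (fun p : ℝ × (Fin m → ℝ) => kahlerPotential (ψ p.1) p.2) ∘ (fun y => (t, y)) from rfl,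
    h1.fderiv]
  rfl

theorem hasDerivAt_potential_fst {t : ℝ} (ht : t ∈ Set.Ioo (0 : ℝ) 1) (y : Fin m → ℝ) :
    HasDerivAt (fun s => kahlerPotential (ψ s) y)
      (fderiv ℝ (fun p : ℝ × (Fin m → ℝ) => kahlerPotential (ψ p.1) p.2) (t, y) (1, 0)) t := by
  have h1 := (h.hasFDerivAt_potential ht y).comp_hasDerivAt t
    ((hasDerivAt_id' t).prodMk (hasDerivAt_const t y))
  exact h1

theorem velocityGradient_eq {t : ℝ} (ht : t ∈ Set.Ioo (0 : ℝ) 1) (y : Fin m → ℝ) (i : Fin m) :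
    velocityGradient ψ t y i = fderiv ℝ (fun p : ℝ × (Fin m → ℝ) =>
      fderiv ℝ (fun p : ℝ × (Fin m → ℝ) => kahlerPotential (ψ p.1) p.2) p (1, 0)) (t, y)
        (0, Pi.single i 1) := by
  have h1 : (fun x => deriv (fun s => kahlerPotential (ψ s) x) t) =
      (fun p : ℝ × (Fin m → ℝ) => fderiv ℝ (fun p : ℝ × (Fin m → ℝ) =>
        kahlerPotential (ψ p.1) p.2) p (1, 0)) ∘ (fun y => (t, y)) :=
    funext fun x => (h.hasDerivAt_potential_fst ht x).deriv
  have h2 := ((h.contDiffAt_fderiv_apply ht y (1, 0)).differentiableAt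
    (by simp)).hasFDerivAt.comp y (hasFDerivAt_prodMk_right t y)
  rw [velocityGradient, partialDeriv, h1, h2.fderiv]
  rfl

theorem acceleration_eq {t : ℝ} (ht : t ∈ Set.Ioo (0 : ℝ) 1) (y : Fin m → ℝ) :
    deriv (fun s => deriv (fun r => kahlerPotential (ψ r) y) s) t =
      fderiv ℝ (fun p : ℝ × (Fin m → ℝ) => fderiv ℝ (fun p : ℝ × (Fin m → ℝ) =>
        kahlerPotential (ψ p.1) p.2) p (1, 0)) (t, y) (1, 0) := by
  have h1 : (fun s => deriv (fun r => kahlerPotential (ψ r) y) s) =ᶠ[𝓝 t]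
      fun s => fderiv ℝ (fun p : ℝ × (Fin m → ℝ) => kahlerPotential (ψ p.1) p.2) (s, y) (1, 0) :=
    (Ioo_mem_nhds ht.1 ht.2 : Set.Ioo (0 : ℝ) 1 ∈ 𝓝 t) |> fun hm => Filter.eventually_of_mem hm
      fun s hs => (h.hasDerivAt_potential_fst hs y).deriv
  rw [h1.deriv_eq]
  exact (((h.contDiffAt_fderiv_apply ht y (1, 0)).differentiableAt
    (by simp)).hasFDerivAt.comp_hasDerivAt t
      ((hasDerivAt_id t).prodMk (hasDerivAt_const t y))).deriv

theorem mixed_partial_symm {t : ℝ} (ht : t ∈ Set.Ioo (0 : ℝ) 1) (y : Fin m → ℝ)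
    (v w : ℝ × (Fin m → ℝ)) :
    fderiv ℝ (fun p : ℝ × (Fin m → ℝ) => fderiv ℝ (fun p : ℝ × (Fin m → ℝ) =>
      kahlerPotential (ψ p.1) p.2) p v) (t, y) w =
    fderiv ℝ (fun p : ℝ × (Fin m → ℝ) => fderiv ℝ (fun p : ℝ × (Fin m → ℝ) =>
      kahlerPotential (ψ p.1) p.2) p w) (t, y) v := by
  have hd : DifferentiableAt ℝ (fderiv ℝ (fun p : ℝ × (Fin m → ℝ) =>
      kahlerPotential (ψ p.1) p.2)) (t, y) :=
    ((h.contDiffAt_potential ht y).fderiv_right (m := ∞) (by simp)).differentiableAt (by simp)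
  have hs : IsSymmSndFDerivAt ℝ (fun p : ℝ × (Fin m → ℝ) => kahlerPotential (ψ p.1) p.2) (t, y) :=
    (h.contDiffAt_potential ht y).isSymmSndFDerivAt (by
      rw [minSmoothness_of_isRCLikeNormedField]; exact ENat.LEInfty.out)
  rw [fderiv_clm_apply hd (differentiableAt_const v), fderiv_clm_apply hd (differentiableAt_const w)]
  simpa using hs.eq w v

theorem contDiffAt_gradient {t : ℝ} (ht : t ∈ Set.Ioo (0 : ℝ) 1) (y : Fin m → ℝ) :
    ContDiffAt ℝ ∞ (fun p : ℝ × (Fin m → ℝ) => coordGradient (kahlerPotential (ψ p.1)) p.2) (t, y) := by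
  refine contDiffAt_pi.2 fun i => (h.contDiffAt_fderiv_apply ht y
    (0, Pi.single i 1)).congr_of_eventuallyEq ?_
  filter_upwards [prod_mem_nhds (Ioo_mem_nhds ht.1 ht.2) (univ_mem (f := 𝓝 y))] with p hp
  rw [show p = (p.1, p.2) from rfl, h.fderiv_potential_snd hp.1, single_one_dotProduct]

theorem fderiv_gradient_fst {t : ℝ} (ht : t ∈ Set.Ioo (0 : ℝ) 1) (y : Fin m → ℝ) :
    fderiv ℝ (fun p : ℝ × (Fin m → ℝ) => coordGradient (kahlerPotential (ψ p.1)) p.2) (t, y) (1, 0) =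
      velocityGradient ψ t y := by
  ext i
  have h1 := ((h.contDiffAt_gradient ht y).differentiableAt (by simp)).hasFDerivAt
  have h2 := hasFDerivAt_pi'.1 h1 i
  have h3 : (fun p : ℝ × (Fin m → ℝ) => coordGradient (kahlerPotential (ψ p.1)) p.2 i) =ᶠ[𝓝 (t, y)]
      fun p => fderiv ℝ (fun p : ℝ × (Fin m → ℝ) => kahlerPotential (ψ p.1) p.2) p
        (0, Pi.single i 1) := by
    filter_upwards [prod_mem_nhds (Ioo_mem_nhds ht.1 ht.2) (univ_mem (f := 𝓝 y))] with p hp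
    rw [show p = (p.1, p.2) from rfl, h.fderiv_potential_snd hp.1, single_one_dotProduct]
  rw [h.velocityGradient_eq ht, h.mixed_partial_symm ht, ← h3.fderiv_eq, h2.fderiv]
  rfl

theorem fderiv_gradient_snd {t : ℝ} (ht : t ∈ Set.Ioo (0 : ℝ) 1) (y v : Fin m → ℝ) :
    fderiv ℝ (fun p : ℝ × (Fin m → ℝ) => coordGradient (kahlerPotential (ψ p.1)) p.2) (t, y) (0, v) =
      v ᵥ* hess (kahlerPotential (ψ t)) y := by
  have hp := h.potential t ⟨ht.1.le, ht.2.le⟩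
  have h1 := ((h.contDiffAt_gradient ht y).differentiableAt (by simp)).hasFDerivAt.comp y
    (hasFDerivAt_prodMk_right t y)
  rw [← fderiv_gradient_apply hp.contDiff_kahlerPotential, show coordGradient (kahlerPotential (ψ t)) =
    (fun p : ℝ × (Fin m → ℝ) => coordGradient (kahlerPotential (ψ p.1)) p.2) ∘ (fun y => (t, y))
    from rfl, h1.fderiv]
  rfl

/-- Invert `(t, y) ↦ (t, ∇φ_t(y))`. Its derivative is block triangular with the invertible Hessian
as the spatial block, so the inverse is smooth jointly in time and momentum. -/
theorem differentiableAt_gradientInv {t : ℝ} (ht : t ∈ Set.Ioo (0 : ℝ) 1) (μ : Fin m → ℝ) :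
    DifferentiableAt ℝ (fun s => gradientInv (kahlerPotential (ψ s)) μ) t := by
  obtain ⟨c, hc⟩ := (h.potential t ⟨ht.1.le, ht.2.le⟩).exists_isUniformlyConvex
  set y := gradientInv (kahlerPotential (ψ t)) μ with hy
  have hgy : coordGradient (kahlerPotential (ψ t)) y = μ := hc.gradient_gradientInv μ
  have hgd := h.contDiffAt_gradient ht y
  have hF : ContDiffAt ℝ ∞ (fun p : ℝ × (Fin m → ℝ) =>
      (p.1, coordGradient (kahlerPotential (ψ p.1)) p.2)) (t, y) := contDiffAt_fst.prodMk hgd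
  have hinv := contDiffAt_of_eventually_leftInverse hF
    (g := fun p => (p.1, gradientInv (kahlerPotential (ψ p.1)) p.2)) (fun v hv => by
      have hd := (hasFDerivAt_fst (𝕜 := ℝ) (p := (t, y))).prodMk
        ((hgd.differentiableAt (by simp)).hasFDerivAt)
      rw [hd.fderiv] at hv
      obtain ⟨v1, v2⟩ := v
      have e1 : v1 = 0 := congrArg Prod.fst hv
      subst e1
      have e2 := congrArg Prod.snd hv
      simp only [ContinuousLinearMap.prod_apply] at e2
      rw [h.fderiv_gradient_snd ht] at e2
      rw [hc.vecMul_hess_eq_zero e2]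
      rfl) (by
      filter_upwards [prod_mem_nhds (Ioo_mem_nhds ht.1 ht.2) (univ_mem (f := 𝓝 y))] with p hp
      obtain ⟨c', hc'⟩ := (h.potential p.1 ⟨hp.1.1.le, hp.1.2.le⟩).exists_isUniformlyConvex
      exact Prod.ext rfl (hc'.gradientInv_gradient p.2))
  simp only [hgy] at hinv
  have h2 : DifferentiableAt ℝ (fun p : ℝ × (Fin m → ℝ) =>
      gradientInv (kahlerPotential (ψ p.1)) p.2) (t, μ) :=
    (contDiffAt_snd.comp _ hinv).differentiableAt (by simp)
  exact DifferentiableAt.comp t (f := fun s : ℝ => (s, μ)) h2 (by fun_prop)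

/-- Envelope principle in time: the motion of the maximiser `Y_t(μ)` contributes nothing, and only
`-φ̇_t(Y_t(μ))` remains. -/
theorem hasDerivAt_legendre {t : ℝ} (ht : t ∈ Set.Ioo (0 : ℝ) 1) (μ : Fin m → ℝ) :
    HasDerivAt (fun s => legendre (kahlerPotential (ψ s)) μ)
      (-fderiv ℝ (fun p : ℝ × (Fin m → ℝ) => kahlerPotential (ψ p.1) p.2)
        (t, gradientInv (kahlerPotential (ψ t)) μ) (1, 0)) t := by
  obtain ⟨c, hc⟩ := (h.potential t ⟨ht.1.le, ht.2.le⟩).exists_isUniformlyConvex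
  have hY := (h.differentiableAt_gradientInv ht μ).hasDerivAt
  set Y' := deriv (fun s => gradientInv (kahlerPotential (ψ s)) μ) t
  have h1 := (h.hasFDerivAt_potential ht (gradientInv (kahlerPotential (ψ t)) μ)).comp_hasDerivAt t
    ((hasDerivAt_id t).prodMk hY)
  have h2 : HasDerivAt (fun s => ∑ i, μ i * gradientInv (kahlerPotential (ψ s)) μ i)
      (∑ i, μ i * Y' i) t :=
    HasDerivAt.fun_sum fun i _ => ((hasDerivAt_pi.1 hY) i).const_mul (μ i)
  have h3 : (fun s => legendre (kahlerPotential (ψ s)) μ) =ᶠ[𝓝 t] fun s =>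
      ∑ i, μ i * gradientInv (kahlerPotential (ψ s)) μ i -
        kahlerPotential (ψ s) (gradientInv (kahlerPotential (ψ s)) μ) := by
    filter_upwards [Ioo_mem_nhds ht.1 ht.2] with s hs
    obtain ⟨c', hc'⟩ := (h.potential s ⟨hs.1.le, hs.2.le⟩).exists_isUniformlyConvex
    exact hc'.legendre_eq μ
  refine ((h2.sub h1).congr_of_eventuallyEq h3).congr_deriv ?_
  have e : ((1 : ℝ), Y') = (1, 0) + (0, Y') := by simp
  rw [e, map_add, h.fderiv_potential_snd ht, hc.gradient_gradientInv, dotProduct_comm Y' μ,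
    dotProduct]
  ring

/-- The only use of the geodesic equation. Differentiating `∇φ_t(Y_t) = μ` in `t` gives `Ẏ = -(Hess
φ)⁻¹∇φ̇`. Therefore `d/dt φ̇_t(Y_t) = φ̈ + ∇φ̇·Ẏ = φ̈ - ∇φ̇ᵀ(Hess φ)⁻¹∇φ̇ = 0`. -/
theorem hasDerivAt_velocity_zero {t : ℝ} (ht : t ∈ Set.Ioo (0 : ℝ) 1) (μ : Fin m → ℝ) :
    HasDerivAt (fun s => fderiv ℝ (fun p : ℝ × (Fin m → ℝ) => kahlerPotential (ψ p.1) p.2)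
        (s, gradientInv (kahlerPotential (ψ s)) μ) (1, 0)) 0 t := by
  obtain ⟨c, hc⟩ := (h.potential t ⟨ht.1.le, ht.2.le⟩).exists_isUniformlyConvex
  have hY := (h.differentiableAt_gradientInv ht μ).hasDerivAt
  set Y' := deriv (fun s => gradientInv (kahlerPotential (ψ s)) μ) t
  set y := gradientInv (kahlerPotential (ψ t)) μ with hy
  have e : ((1 : ℝ), Y') = (1, 0) + (0, Y') := by simp
  have hg := ((h.contDiffAt_gradient ht y).differentiableAt (by simp)).hasFDerivAt.comp_hasDerivAt t
    ((hasDerivAt_id t).prodMk hY)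
  have hconst : (fun _ : ℝ => μ) =ᶠ[𝓝 t] (fun p : ℝ × (Fin m → ℝ) =>
      coordGradient (kahlerPotential (ψ p.1)) p.2) ∘
        fun s => (id s, gradientInv (kahlerPotential (ψ s)) μ) := by
    filter_upwards [Ioo_mem_nhds ht.1 ht.2] with s hs
    obtain ⟨c', hc'⟩ := (h.potential s ⟨hs.1.le, hs.2.le⟩).exists_isUniformlyConvex
    exact (hc'.gradient_gradientInv μ).symm
  have h0 := (hg.congr_of_eventuallyEq hconst).unique (hasDerivAt_const t μ)
  rw [e, map_add, h.fderiv_gradient_fst ht, h.fderiv_gradient_snd ht] at h0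
  have hunit : IsUnit (hess (kahlerPotential (ψ t)) y).det := (hc.posDef y).det_pos.ne'.isUnit
  have hY' : Y' = -(velocityGradient ψ t y ᵥ* (hess (kahlerPotential (ψ t)) y)⁻¹) := by
    have h1 := eq_neg_of_add_eq_zero_right h0
    have h2 := congrArg (fun v => v ᵥ* (hess (kahlerPotential (ψ t)) y)⁻¹) h1
    simp only [Matrix.vecMul_vecMul, Matrix.mul_nonsing_inv _ hunit, Matrix.vecMul_one,
      Matrix.neg_vecMul] at h2
    exact h2
  have hW := ((h.contDiffAt_fderiv_apply ht y (1, 0)).differentiableAt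
    (by simp)).hasFDerivAt.comp_hasDerivAt t ((hasDerivAt_id t).prodMk hY)
  refine hW.congr_deriv ?_
  have hv : fderiv ℝ (fun p : ℝ × (Fin m → ℝ) => fderiv ℝ (fun p : ℝ × (Fin m → ℝ) =>
      kahlerPotential (ψ p.1) p.2) p (1, 0)) (t, y) (0, Y') = Y' ⬝ᵥ velocityGradient ψ t y := by
    have := clm_apply_eq_dotProduct ((fderiv ℝ (fun p : ℝ × (Fin m → ℝ) =>
      fderiv ℝ (fun p : ℝ × (Fin m → ℝ) => kahlerPotential (ψ p.1) p.2) p (1, 0)) (t, y)).comp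
      (ContinuousLinearMap.inr ℝ ℝ (Fin m → ℝ))) Y'
    simp only [ContinuousLinearMap.comp_apply, ContinuousLinearMap.inr_apply,
      ← h.velocityGradient_eq ht] at this
    exact this
  rw [e, map_add, ← h.acceleration_eq ht, h.geodesic t ht, hv, hY', Matrix.dotProduct_mulVec,
    neg_dotProduct]
  ring

/-- The differential identities hold only for `0 < t < 1`, so continuity is needed to reach the
endpoints. The difference `φ_s - φ_r = 4π(ψ_s - ψ_r)` is periodic in `y`, hence uniformly small, and
suprema inherit this. -/
theorem continuousOn_legendre (μ : Fin m → ℝ) :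
    ContinuousOn (fun s => legendre (kahlerPotential (ψ s)) μ) (Set.Icc 0 1) := by
  have hK : IsCompact (Set.Icc (0 : ℝ) 1 ×ˢ Set.Icc (0 : Fin m → ℝ) (fun _ => 1)) :=
    isCompact_Icc.prod isCompact_Icc
  have hu := hK.uniformContinuousOn_of_continuous
    (h.smooth.continuousOn.mono (Set.prod_mono_right (Set.subset_univ _)))
  rw [Metric.uniformContinuousOn_iff] at hu
  rw [Metric.continuousOn_iff]
  intro t ht ε hε
  obtain ⟨δ, hδ, hb⟩ := hu (ε / (8 * Real.pi)) (by positivity)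
  have key : ∀ s ∈ Set.Icc (0 : ℝ) 1, ∀ r ∈ Set.Icc (0 : ℝ) 1, dist s r < δ →
      legendre (kahlerPotential (ψ s)) μ ≤ legendre (kahlerPotential (ψ r)) μ + ε / 2 := by
    intro s hs r hr hsr
    obtain ⟨c, hc⟩ := (h.potential s hs).exists_isUniformlyConvex
    obtain ⟨c', hc'⟩ := (h.potential r hr).exists_isUniformlyConvex
    set y := gradientInv (kahlerPotential (ψ s)) μ
    obtain ⟨n, hn⟩ := exists_add_mem_Icc (c := 1) one_pos y
    have h1 := hb (s, _) ⟨hs, hn⟩ (r, _) ⟨hr, hn⟩ (by simpa [Prod.dist_eq, hδ] using hsr)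
    dsimp only at h1
    rw [(h.potential s hs).periodic n y, (h.potential r hr).periodic n y, Real.dist_eq] at h1
    have h2 := (abs_lt.1 h1).1
    have h3 : 4 * Real.pi * (ψ r y - ψ s y) ≤ ε / 2 := by
      have : ε / 2 = 4 * Real.pi * (ε / (8 * Real.pi)) := by field_simp; norm_num
      rw [this]
      gcongr
      linarith
    have h4 := hc'.le_legendre μ y
    rw [hc.legendre_eq μ]
    have h5 : kahlerPotential (ψ r) y - kahlerPotential (ψ s) y =
      4 * Real.pi * (ψ r y - ψ s y) := by simp only [kahlerPotential]; ring
    change μ ⬝ᵥ y - kahlerPotential (ψ s) y ≤ _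
    linarith
  refine ⟨δ, hδ, fun s hs hst => ?_⟩
  rw [Real.dist_eq, abs_lt]
  have h1 := key s hs t ht hst
  have h2 := key t ht s hs (by rwa [dist_comm])
  constructor <;> linarith

theorem legendre_affine {t : ℝ} (ht : t ∈ Set.Icc (0 : ℝ) 1) (μ : Fin m → ℝ) :
    legendre (kahlerPotential (ψ t)) μ = (1 - t) * legendre (kahlerPotential (ψ 0)) μ +
      t * legendre (kahlerPotential (ψ 1)) μ := by
  set U := fun s => legendre (kahlerPotential (ψ s)) μ with hU
  set W := fun s => fderiv ℝ (fun p : ℝ × (Fin m → ℝ) => kahlerPotential (ψ p.1) p.2)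
        (s, gradientInv (kahlerPotential (ψ s)) μ) (1, 0) with hW
  -- The velocity at `Y_s(μ)` is constant on the open interval; `1 / 2` is merely a base point. Thus
  -- the time derivative of `u` is constant there.
  have hWc : ∀ s ∈ Set.Ioo (0 : ℝ) 1, W s = W (1 / 2) := fun s hs =>
    isOpen_Ioo.is_const_of_deriv_eq_zero isPreconnected_Ioo
      (fun s hs => (h.hasDerivAt_velocity_zero hs μ).differentiableAt.differentiableWithinAt)
      (fun s hs => (h.hasDerivAt_velocity_zero hs μ).deriv) hs (by norm_num)
  have hcont : ContinuousOn (fun s => U s + W (1 / 2) * s) (Set.Icc 0 1) :=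
    (h.continuousOn_legendre μ).add (by fun_prop)
  have hd : ∀ s ∈ interior (Set.Icc (0 : ℝ) 1),
      HasDerivAt (fun s => U s + W (1 / 2) * s) 0 s := by
    intro s hs
    rw [interior_Icc] at hs
    refine ((h.hasDerivAt_legendre hs μ).add ((hasDerivAt_id' s).const_mul _)).congr_deriv ?_
    rw [← hWc s hs]
    simp [hW]
  have hmono := monotoneOn_of_deriv_nonneg (convex_Icc 0 1) hcont
    (fun s hs => (hd s hs).differentiableAt.differentiableWithinAt) fun s hs => (hd s hs).deriv.ge
  have hanti := antitoneOn_of_deriv_nonpos (convex_Icc 0 1) hcont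
    (fun s hs => (hd s hs).differentiableAt.differentiableWithinAt) fun s hs => (hd s hs).deriv.le
  have hc : ∀ s ∈ Set.Icc (0 : ℝ) 1, U s + W (1 / 2) * s = U 0 + W (1 / 2) * 0 := fun s hs =>
    le_antisymm (hanti (by simp) hs hs.1) (hmono (by simp) hs hs.1)
  have e1 := hc t ht
  have e2 := hc 1 (by simp)
  change U t = (1 - t) * U 0 + t * U 1
  linear_combination e1 - t * e2

end IsSmoothGeodesic

/-! ### Theta series: summability, Parseval and unfolding -/

theorem summable_pi_prod {m : ℕ} {f : Fin m → ℤ → ℝ} (hf : ∀ i, Summable (f i))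
    (h0 : ∀ i a, 0 ≤ f i a) : Summable fun n : Fin m → ℤ => ∏ i, f i (n i) := by
  induction m with
  | zero => exact (hasSum_fintype _).summable
  | succ m ih =>
    have h1 := (hf 0).mul_of_nonneg (ih (f := fun i => f i.succ) (fun i => hf _) fun i a => h0 _ _)
      (h0 0) (fun n => Finset.prod_nonneg fun i _ => h0 _ _)
    rw [← (Fin.consEquiv fun _ => ℤ).summable_iff]
    refine h1.congr fun x => ?_
    simp [Fin.prod_univ_succ, Fin.consEquiv]

theorem summable_exp_neg_abs_int : Summable fun a : ℤ => Real.exp (-|(a : ℝ)|) := by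
  apply Summable.of_nat_of_neg <;> simpa using Real.summable_exp_neg_nat

/-- The term `2π|j + ka|` is the worst growth of a theta term for `0 ≤ y ≤ 1`, so this yields a
majorant uniform over the cube. -/
theorem summable_gaussian_int {k : ℕ} (hk : 1 ≤ k) (j : ℤ) :
    Summable fun a : ℤ => Real.exp (-Real.pi * ((j : ℝ) + k * a) ^ 2 / k +
      2 * Real.pi * |(j : ℝ) + k * a|) := by
  have hk' : (1 : ℝ) ≤ k := by exact_mod_cast hk
  have hπ := Real.pi_pos
  refine ((summable_exp_neg_abs_int.mul_left (Real.exp (|(j : ℝ)| +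
    (2 * Real.pi + 1) ^ 2 * k / (4 * Real.pi))))).of_nonneg_of_le (fun _ => (Real.exp_pos _).le)
    fun a => ?_
  rw [← Real.exp_add]
  refine Real.exp_le_exp.2 ?_
  set r := |(j : ℝ) + k * a| with hr
  have h1 : |(a : ℝ)| ≤ r + |(j : ℝ)| := by
    have h2 : |(k : ℝ) * a| ≤ r + |(j : ℝ)| := by
      have := abs_sub ((j : ℝ) + k * a) j
      rwa [add_sub_cancel_left] at this
    rw [abs_mul, abs_of_nonneg (by linarith : (0 : ℝ) ≤ k)] at h2
    nlinarith [abs_nonneg (a : ℝ)]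
  have h3 : ((j : ℝ) + k * a) ^ 2 = r ^ 2 := (sq_abs _).symm
  rw [h3]
  -- Completing the square. The extra `1` beside `2π` pays for the factor `exp(-|a|)`, since `|a| ≤
  -- r + |j|`.
  have h4 : (2 * Real.pi + 1) * r ≤ Real.pi * r ^ 2 / k +
      (2 * Real.pi + 1) ^ 2 * k / (4 * Real.pi) := by
    have h5 : Real.pi * r ^ 2 / k + (2 * Real.pi + 1) ^ 2 * k / (4 * Real.pi) -
        (2 * Real.pi + 1) * r = (2 * Real.pi * r - (2 * Real.pi + 1) * k) ^ 2 /
          (4 * Real.pi * k) := by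
      field_simp
      ring
    have h6 : 0 ≤ (2 * Real.pi * r - (2 * Real.pi + 1) * k) ^ 2 / (4 * Real.pi * k) := by
      positivity
    linarith
  have h7 : -Real.pi * r ^ 2 / k = -(Real.pi * r ^ 2 / k) := by ring
  rw [h7]
  linarith

theorem integral_unitInterval_exp (N : ℤ) :
    ∫ x in Set.Icc (0 : ℝ) 1, Complex.exp (2 * Real.pi * Complex.I * N * x) =
      if N = 0 then 1 else 0 := by
  rw [integral_Icc_eq_integral_Ioc, ← intervalIntegral.integral_of_le zero_le_one]
  split_ifs with h
  · simp [h]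
  · have hc : (2 * Real.pi * Complex.I * N : ℂ) ≠ 0 := by
      simp [h, Real.pi_ne_zero]
    rw [integral_exp_mul_complex hc]
    have : Complex.exp (2 * Real.pi * Complex.I * N) = 1 := by
      rw [mul_comm]
      exact Complex.exp_int_mul_two_pi_mul_I N
    simp [this]

theorem setIntegral_unitCube_exp {m : ℕ} (l : Fin m → ℤ) :
    ∫ x in Set.Icc (0 : Fin m → ℝ) 1, ∏ i, Complex.exp (2 * Real.pi * Complex.I * l i * x i) =
      if l = 0 then 1 else 0 := by
  rw [← Set.pi_univ_Icc, volume_pi, Measure.restrict_pi_pi,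
    integral_fintype_prod_eq_prod (fun i (x : ℝ) =>
      Complex.exp (2 * Real.pi * Complex.I * l i * x))]
  simp only [Pi.zero_apply, Pi.one_apply, integral_unitInterval_exp]
  split_ifs with h
  · simp [h]
  · obtain ⟨i, hi⟩ := Function.ne_iff.1 h
    exact Finset.prod_eq_zero (Finset.mem_univ i) (if_neg hi)

/-- The integer translates of the half-open cube tile `ℝ^m`; replacing each by the closed cube
changes only a null set. -/
theorem hasSum_setIntegral_unitCube {m : ℕ} {g : (Fin m → ℝ) → ℝ} (hg : Integrable g) :
    HasSum (fun n : Fin m → ℤ => ∫ y in Set.Icc (0 : Fin m → ℝ) 1, g (y + fun i => (n i : ℝ)))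
      (∫ y, g y) := by
  set B : (Fin m → ℤ) → Set (Fin m → ℝ) := fun n =>
    Set.pi Set.univ fun i => Set.Ico (n i : ℝ) (n i + 1) with hB
  have hmem : ∀ n y, y ∈ B n ↔ ∀ i, ⌊y i⌋ = n i := fun n y => by
    simp only [hB, Set.mem_univ_pi, Set.mem_Ico, Int.floor_eq_iff]
  have hU : ⋃ n, B n = Set.univ := Set.eq_univ_of_forall fun y =>
    Set.mem_iUnion.2 ⟨fun i => ⌊y i⌋, (hmem _ _).2 fun _ => rfl⟩
  have hd : Pairwise (Function.onFun Disjoint B) := fun n n' hn =>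
    Set.disjoint_left.2 fun y hy hy' => hn (funext fun i => by
      rw [← (hmem n y).1 hy i, (hmem n' y).1 hy' i])
  have h1 := hasSum_integral_iUnion (μ := volume) (f := g) (s := B)
    (fun n => MeasurableSet.univ_pi fun i => measurableSet_Ico) hd hg.integrableOn
  rw [hU, setIntegral_univ] at h1
  suffices key : ∀ n : Fin m → ℤ, ∫ y in Set.Icc (0 : Fin m → ℝ) 1, g (y + fun i => (n i : ℝ)) =
      ∫ y in B n, g y by simpa only [key] using h1
  intro n
  have h2 := (measurePreserving_add_right (volume : Measure (Fin m → ℝ))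
    (fun i => (n i : ℝ))).setIntegral_preimage_emb
    (MeasurableEquiv.addRight (fun i => (n i : ℝ))).measurableEmbedding g (B n)
  rw [← h2]
  have h3 : (fun y : Fin m → ℝ => y + fun i => (n i : ℝ)) ⁻¹' B n =
      Set.pi Set.univ fun i => Set.Ico ((0 : Fin m → ℝ) i) ((1 : Fin m → ℝ) i) := by
    ext y
    simp only [hB, Set.mem_preimage, Set.mem_univ_pi, Set.mem_Ico, Pi.add_apply, Pi.zero_apply,
      Pi.one_apply]
    exact forall_congr' fun i => ⟨fun h => ⟨by linarith [h.1], by linarith [h.2]⟩,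
      fun h => ⟨by linarith [h.1], by linarith [h.2]⟩⟩
  rw [h3]
  exact (setIntegral_congr_set Measure.univ_pi_Ico_ae_eq_Icc).symm

section

variable {m : ℕ}

/-- The modulus of the `n`-th term of the theta series. -/
noncomputable def thetaCoeff (k : ℕ) (j n : Fin m → ℤ) (y : Fin m → ℝ) : ℝ :=
  Real.exp (∑ i, (-Real.pi * ((j i : ℝ) + k * n i) ^ 2 / k -
    2 * Real.pi * ((j i : ℝ) + k * n i) * y i))

/-- A bound for the modulus of the `n`-th term of the theta series on the unit cube. -/
noncomputable def thetaBound (k : ℕ) (j n : Fin m → ℤ) : ℝ :=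
  ∏ i, Real.exp (-Real.pi * ((j i : ℝ) + k * n i) ^ 2 / k + 2 * Real.pi * |(j i : ℝ) + k * n i|)

theorem thetaCoeff_nonneg (k : ℕ) (j n : Fin m → ℤ) (y : Fin m → ℝ) : 0 ≤ thetaCoeff k j n y :=
  (Real.exp_pos _).le

theorem thetaBound_nonneg (k : ℕ) (j n : Fin m → ℤ) : 0 ≤ thetaBound k j n :=
  Finset.prod_nonneg fun _ _ => (Real.exp_pos _).le

theorem summable_thetaBound {k : ℕ} (hk : 1 ≤ k) (j : Fin m → ℤ) :
    Summable (thetaBound k j) :=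
  summable_pi_prod (f := fun i a => Real.exp (-Real.pi * ((j i : ℝ) + k * a) ^ 2 / k +
    2 * Real.pi * |(j i : ℝ) + k * a|)) (fun i => summable_gaussian_int hk (j i))
    fun _ _ => (Real.exp_pos _).le

theorem thetaCoeff_le {k : ℕ} (j n : Fin m → ℤ) {y : Fin m → ℝ}
    (hy : y ∈ Set.Icc (0 : Fin m → ℝ) 1) : thetaCoeff k j n y ≤ thetaBound k j n := by
  rw [thetaCoeff, thetaBound, Real.exp_sum]
  refine Finset.prod_le_prod (fun _ _ => (Real.exp_pos _).le) fun i _ => Real.exp_le_exp.2 ?_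
  have h0 : 0 ≤ y i := hy.1 i
  have h1 : y i ≤ 1 := hy.2 i
  set x := (j i : ℝ) + k * n i
  have h2 : -(x * y i) ≤ |x| := by
    have : |x * y i| ≤ |x| := by
      rw [abs_mul, abs_of_nonneg h0]
      exact mul_le_of_le_one_right (abs_nonneg x) h1
    linarith [neg_abs_le (x * y i)]
  nlinarith [Real.pi_pos]

/-- The terms of the theta series split into a modulus and a character. -/
theorem thetaTerm_eq (k : ℕ) (j n : Fin m → ℤ) (x y : Fin m → ℝ) :
    Complex.exp (-(Real.pi : ℂ) * (∑ i, ((j i : ℂ) + (k : ℂ) * (n i : ℂ)) ^ 2) / (k : ℂ)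
      + 2 * (Real.pi : ℂ) * Complex.I * ∑ i, ((j i : ℂ) + (k : ℂ) * (n i : ℂ)) *
        ((x i : ℂ) + Complex.I * (y i : ℂ))) =
    (thetaCoeff k j n y : ℂ) *
      ∏ i, Complex.exp (2 * Real.pi * Complex.I * ((j i : ℂ) + k * n i) * x i) := by
  rw [thetaCoeff, Complex.ofReal_exp, ← Complex.exp_sum, ← Complex.exp_add]
  congr 1
  push_cast
  rw [Finset.mul_sum, Finset.sum_div, Finset.mul_sum, ← Finset.sum_add_distrib,
    ← Finset.sum_add_distrib]
  refine Finset.sum_congr rfl fun i _ => ?_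
  linear_combination (2 * (Real.pi : ℂ) * ((j i : ℂ) + k * n i) * y i) * Complex.I_mul_I

theorem norm_character (k : ℕ) (j n : Fin m → ℤ) (x : Fin m → ℝ) :
    ‖∏ i, Complex.exp (2 * Real.pi * Complex.I * ((j i : ℂ) + k * n i) * x i)‖ = 1 := by
  rw [norm_prod]
  refine Finset.prod_eq_one fun i _ => ?_
  have : 2 * Real.pi * Complex.I * ((j i : ℂ) + k * n i) * x i =
      ((2 * Real.pi * ((j i : ℝ) + k * n i) * x i : ℝ) : ℂ) * Complex.I := by
    push_cast
    ring
  rw [this, Complex.norm_exp_ofReal_mul_I]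

theorem character_mul_conj (k : ℕ) (j n n' : Fin m → ℤ) (x : Fin m → ℝ) :
    (∏ i, Complex.exp (2 * Real.pi * Complex.I * ((j i : ℂ) + k * n i) * x i)) *
      (starRingEnd ℂ) (∏ i, Complex.exp (2 * Real.pi * Complex.I * ((j i : ℂ) + k * n' i) * x i)) =
    ∏ i, Complex.exp (2 * Real.pi * Complex.I * ((k * (n i - n' i) : ℤ) : ℂ) * x i) := by
  rw [map_prod, ← Finset.prod_mul_distrib]
  refine Finset.prod_congr rfl fun i _ => ?_
  rw [← Complex.exp_conj, ← Complex.exp_add]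
  congr 1
  simp only [map_mul, map_add, Complex.conj_ofReal, Complex.conj_I, map_natCast, map_intCast,
    map_ofNat]
  push_cast
  ring

/-- The squared modulus of the theta function as a double series. -/
theorem normSq_thetaFun {k : ℕ} (hk : 1 ≤ k) (j : Fin m → ℤ) (x : Fin m → ℝ) {y : Fin m → ℝ}
    (hy : y ∈ Set.Icc (0 : Fin m → ℝ) 1) :
    ((‖thetaFun k j (fun i => (x i : ℂ) + Complex.I * (y i : ℂ))‖ ^ 2 : ℝ) : ℂ) =
      ∑' q : (Fin m → ℤ) × (Fin m → ℤ),
        (∏ i, Complex.exp (2 * Real.pi * Complex.I * ((k * (q.1 i - q.2 i) : ℤ) : ℂ) * x i)) *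
          ((thetaCoeff k j q.1 y * thetaCoeff k j q.2 y : ℝ) : ℂ) := by
  have hs : Summable fun n => ‖(thetaCoeff k j n y : ℂ) *
      ∏ i, Complex.exp (2 * Real.pi * Complex.I * ((j i : ℂ) + k * n i) * x i)‖ := by
    refine (summable_thetaBound hk j).of_nonneg_of_le (fun _ => norm_nonneg _) fun n => ?_
    rw [norm_mul, norm_character, mul_one, Complex.norm_real,
      Real.norm_of_nonneg (thetaCoeff_nonneg _ _ _ _)]
    exact thetaCoeff_le j n hy
  have hs' : Summable fun n => ‖(starRingEnd ℂ) ((thetaCoeff k j n y : ℂ) *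
      ∏ i, Complex.exp (2 * Real.pi * Complex.I * ((j i : ℂ) + k * n i) * x i))‖ := by
    simpa only [RCLike.norm_conj] using hs
  have hθ : thetaFun k j (fun i => (x i : ℂ) + Complex.I * (y i : ℂ)) =
      ∑' n, (thetaCoeff k j n y : ℂ) *
        ∏ i, Complex.exp (2 * Real.pi * Complex.I * ((j i : ℂ) + k * n i) * x i) :=
    tsum_congr fun n => thetaTerm_eq k j n x y
  have h1 := Complex.mul_conj' (thetaFun k j (fun i => (x i : ℂ) + Complex.I * (y i : ℂ)))
  rw [Complex.ofReal_pow, ← h1, hθ, Complex.conj_tsum, tsum_mul_tsum_of_summable_norm hs hs']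
  refine tsum_congr fun q => ?_
  rw [map_mul, Complex.conj_ofReal, mul_mul_mul_comm, character_mul_conj]
  push_cast
  ring

/-- Parseval's identity for the theta function against a continuous weight in `y`. -/
theorem hasSum_integral_normSq_thetaFun {k : ℕ} (hk : 1 ≤ k) (j : Fin m → ℤ)
    {w : (Fin m → ℝ) → ℝ} (hw : Continuous w) :
    HasSum (fun n => ∫ y in Set.Icc (0 : Fin m → ℝ) 1, thetaCoeff k j n y ^ 2 * w y)
      (∫ p in (Set.Icc (0 : Fin m → ℝ) 1 ×ˢ Set.Icc (0 : Fin m → ℝ) 1),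
        ‖thetaFun k j (fun i => (p.1 i : ℂ) + Complex.I * (p.2 i : ℂ))‖ ^ 2 * w p.2) := by
  have hcoeff : ∀ n, Continuous (thetaCoeff k j n) := fun n => by
    unfold thetaCoeff
    fun_prop
  have hk0 : (k : ℤ) ≠ 0 := by exact_mod_cast (by omega : k ≠ 0)
  set S := Set.Icc (0 : Fin m → ℝ) 1 ×ˢ Set.Icc (0 : Fin m → ℝ) 1 with hS
  have hScpt : IsCompact S := isCompact_Icc.prod isCompact_Icc
  have hSm : MeasurableSet S := hScpt.measurableSet
  obtain ⟨M, hM⟩ := (isCompact_Icc (a := (0 : Fin m → ℝ)) (b := 1)).bddAbove_image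
    hw.norm.continuousOn
  set F : (Fin m → ℤ) × (Fin m → ℤ) → (Fin m → ℝ) × (Fin m → ℝ) → ℂ := fun q p =>
    (∏ i, Complex.exp (2 * Real.pi * Complex.I * ((k * (q.1 i - q.2 i) : ℤ) : ℂ) * p.1 i)) *
      ((thetaCoeff k j q.1 p.2 * thetaCoeff k j q.2 p.2 * w p.2 : ℝ) : ℂ) with hF
  have hFc : ∀ q, Continuous (F q) := fun q => by
    have h1 := (hcoeff q.1).comp (continuous_snd (X := Fin m → ℝ))
    have h2 := (hcoeff q.2).comp (continuous_snd (X := Fin m → ℝ))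
    have h3 := hw.comp (continuous_snd (X := Fin m → ℝ))
    exact (by fun_prop : Continuous fun p : (Fin m → ℝ) × (Fin m → ℝ) =>
      ∏ i, Complex.exp (2 * Real.pi * Complex.I * ((k * (q.1 i - q.2 i) : ℤ) : ℂ) * p.1 i)).mul
        (Complex.continuous_ofReal.comp ((h1.mul h2).mul h3))
  have hFi : ∀ q, Integrable (F q) (volume.restrict S) := fun q =>
    (hFc q).continuousOn.integrableOn_compact hScpt
  have hFb : ∀ q, ∀ p ∈ S, ‖F q p‖ ≤ thetaBound k j q.1 * thetaBound k j q.2 * M := by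
    intro q p hp
    have h1 : ‖w p.2‖ ≤ M := hM ⟨p.2, hp.2, rfl⟩
    have hc := character_mul_conj k j q.1 q.2 p.1
    simp only [hF]
    rw [norm_mul, ← hc, norm_mul, RCLike.norm_conj, norm_character, norm_character, mul_one,
      one_mul, Complex.norm_real, norm_mul, norm_mul,
      Real.norm_of_nonneg (thetaCoeff_nonneg _ _ _ _),
      Real.norm_of_nonneg (thetaCoeff_nonneg _ _ _ _)]
    have := thetaBound_nonneg k j q.1
    have := thetaBound_nonneg k j q.2
    gcongr
    · exact thetaCoeff_nonneg _ _ _ _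
    · exact thetaCoeff_le j _ hp.2
    · exact thetaCoeff_le j _ hp.2
  have hFs : Summable fun q => ∫ p in S, ‖F q p‖ := by
    refine (((summable_thetaBound hk j).mul_of_nonneg (summable_thetaBound hk j)
      (thetaBound_nonneg k j) (thetaBound_nonneg k j)).mul_right
        (M * volume.real S)).of_nonneg_of_le
      (fun q => integral_nonneg fun p => norm_nonneg _) fun q => ?_
    rw [← mul_assoc]
    calc ∫ p in S, ‖F q p‖ ≤ ∫ p in S, thetaBound k j q.1 * thetaBound k j q.2 * M :=
          setIntegral_mono_on (hFi q).norm
            (integrableOn_const hScpt.measure_lt_top.ne) hSm (hFb q)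
      _ = _ := by rw [setIntegral_const, smul_eq_mul, mul_comm]
  have h1 := hasSum_integral_of_summable_integral_norm hFi hFs
  have h2 : ∫ p in S, ∑' q, F q p = ((∫ p in S,
      ‖thetaFun k j (fun i => (p.1 i : ℂ) + Complex.I * (p.2 i : ℂ))‖ ^ 2 * w p.2 : ℝ) : ℂ) := by
    rw [← integral_complex_ofReal]
    refine setIntegral_congr_fun hSm fun p hp => ?_
    simp only [hF]
    rw [Complex.ofReal_mul, normSq_thetaFun hk j p.1 hp.2, ← tsum_mul_right]
    refine tsum_congr fun q => ?_
    push_cast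
    ring
  -- The `x`-integral of the character with frequencies `k(q.1 - q.2)` vanishes off the diagonal
  -- because `k ≠ 0`.
  have h3 : ∀ q, ∫ p in S, F q p = if q.1 = q.2 then
      ((∫ y in Set.Icc (0 : Fin m → ℝ) 1, thetaCoeff k j q.1 y ^ 2 * w y : ℝ) : ℂ) else 0 := by
    intro q
    rw [hS, Measure.volume_eq_prod, setIntegral_prod_mul (fun x : Fin m → ℝ =>
      ∏ i, Complex.exp (2 * Real.pi * Complex.I * ((k * (q.1 i - q.2 i) : ℤ) : ℂ) * x i))
      (fun y => ((thetaCoeff k j q.1 y * thetaCoeff k j q.2 y * w y : ℝ) : ℂ)),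
      setIntegral_unitCube_exp (fun i => k * (q.1 i - q.2 i))]
    by_cases h : q.1 = q.2
    · have h' : (fun i => (k : ℤ) * (q.1 i - q.2 i)) = 0 := by ext i; simp [h]
      rw [if_pos h, if_pos h', one_mul, ← integral_complex_ofReal, ← h]
      simp only [sq]
    · have h' : (fun i => (k : ℤ) * (q.1 i - q.2 i)) ≠ 0 := fun h0 => h (funext fun i => by
        have := congrFun h0 i
        simp only [Pi.zero_apply, mul_eq_zero, hk0, false_or] at this
        linarith)
      rw [if_neg h, if_neg h', zero_mul]
  rw [h2, funext h3] at h1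
  have hinj : Function.Injective fun n : Fin m → ℤ => (n, n) := fun n n' h => congrArg Prod.fst h
  have h4 := (hinj.hasSum_iff fun q hq => if_neg fun h => hq ⟨q.1, Prod.ext rfl h⟩).2 h1
  refine Complex.hasSum_ofReal.1 ?_
  simpa [Function.comp_def] using h4

end

/-! ### Norming constants as Laplace integrals -/

section

variable {m : ℕ}

/-- The integrand is the derivative of `s (v·∇u(μ+sv)) - u(μ+sv)`. In this form `v = εw` releases a
factor `ε²` exactly, leaving a phase that is smooth through `ε = 0`. -/
theorem bregman_eq_integral {u : (Fin m → ℝ) → ℝ} (hu : ContDiff ℝ ∞ u) (μ v : Fin m → ℝ) :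
    u μ - u (μ + v) + v ⬝ᵥ coordGradient u (μ + v) =
      ∫ s in Set.Icc (0 : ℝ) 1, s * (v ⬝ᵥ hess u (μ + s • v) *ᵥ v) := by
  have hcont : Continuous fun s : ℝ => s * (v ⬝ᵥ hess u (μ + s • v) *ᵥ v) := by
    have h1 : Continuous (hess u) := continuous_matrix fun i j => (contDiff_hess hu i j).continuous
    have h2 : Continuous fun s : ℝ => hess u (μ + s • v) := h1.comp (by fun_prop)
    exact continuous_id.mul (continuous_const.dotProduct (h2.matrix_mulVec continuous_const))
  have hd : ∀ s ∈ Set.uIcc (0 : ℝ) 1, HasDerivAt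
      (fun s : ℝ => s * (v ⬝ᵥ coordGradient u (μ + s • v)) - u (μ + s • v))
      (s * (v ⬝ᵥ hess u (μ + s • v) *ᵥ v)) s := fun s _ => by
    refine (((hasDerivAt_id' s).mul (hasDerivAt_gradient_line hu μ v s)).sub
      (hasDerivAt_comp_line hu μ v s)).congr_deriv ?_
    ring
  have h := intervalIntegral.integral_eq_sub_of_hasDerivAt hd (hcont.intervalIntegrable 0 1)
  rw [integral_Icc_eq_integral_Ioc, ← intervalIntegral.integral_of_le zero_le_one, h]
  simp only [one_smul, one_mul, zero_mul, zero_smul, add_zero, zero_sub]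
  ring

theorem IsUniformlyConvex.integral_comp_gradient {φ : (Fin m → ℝ) → ℝ} {c : ℝ}
    (h : IsUniformlyConvex φ c) (f : (Fin m → ℝ) → ℝ) :
    ∫ y, f (coordGradient φ y) * (hess φ y).det = ∫ p, f p := by
  have hd : ∀ y ∈ (Set.univ : Set (Fin m → ℝ)), HasFDerivWithinAt (coordGradient φ)
      (fderiv ℝ (coordGradient φ) y) Set.univ y := fun y _ =>
    ((contDiff_gradient h.smooth).differentiable (by simp) y).hasFDerivAt.hasFDerivWithinAt
  have h1 := integral_image_eq_integral_abs_det_fderiv_smul volume MeasurableSet.univ hd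
    h.gradient_injective.injOn f
  rw [Set.image_univ, h.gradient_surjective.range_eq, setIntegral_univ, setIntegral_univ] at h1
  rw [h1]
  refine integral_congr_ae (Eventually.of_forall fun y => ?_)
  have h2 : (fderiv ℝ (coordGradient φ) y : (Fin m → ℝ) →ₗ[ℝ] (Fin m → ℝ)) =
      Matrix.toLin' (hess φ y)ᵀ := by
    ext1 w
    ext
    simp [fderiv_gradient_apply h.smooth]
  have h3 : (fderiv ℝ (coordGradient φ) y).det = (hess φ y).det := by
    rw [ContinuousLinearMap.det, h2, LinearMap.det_toLin', Matrix.det_transpose]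
  dsimp only
  rw [h3, abs_of_pos (h.posDef y).det_pos, smul_eq_mul, mul_comm]

/-- With `p = ∇φ(y)`, Legendre duality turns `φ(y) - μ·y` into `-u(μ)` plus the Bregman divergence
of `u` between `μ` and `p`. The scaling `p = μ + εw` with `kε² = 1` then removes `k` from the
leading quadratic term. -/
theorem IsUniformlyConvex.integral_exp_legendre {φ : (Fin m → ℝ) → ℝ} {c : ℝ}
    (h : IsUniformlyConvex φ c) (μ : Fin m → ℝ) (q : ℝ) {k : ℕ} (hk : 1 ≤ k) :
    ∫ y, Real.exp (-k * (φ y - μ ⬝ᵥ y + q)) * (hess φ y).det =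
      Real.exp (k * (legendre φ μ - q)) * ((√k)⁻¹ ^ m *
        ∫ w : Fin m → ℝ, Real.exp (-∫ s in Set.Icc (0 : ℝ) 1,
          s * (w ⬝ᵥ hess (legendre φ) (μ + (s * (√k)⁻¹) • w) *ᵥ w))) := by
  have hk0 : (0 : ℝ) < k := by exact_mod_cast hk
  set ε : ℝ := (√k)⁻¹ with hε
  have hε0 : 0 < ε := by positivity
  have hkε : (k : ℝ) * ε ^ 2 = 1 := by
    rw [hε, inv_pow, Real.sq_sqrt hk0.le, mul_inv_cancel₀ hk0.ne']
  set f : (Fin m → ℝ) → ℝ := fun p =>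
    Real.exp (-k * (φ (gradientInv φ p) - μ ⬝ᵥ gradientInv φ p + q)) with hf
  have h1 := h.integral_comp_gradient f
  simp only [hf, h.gradientInv_gradient] at h1
  rw [h1]
  change ∫ p, f p = _
  rw [← integral_add_left_eq_self f μ]
  have h2 := Measure.integral_comp_smul (volume : Measure (Fin m → ℝ)) (fun v => f (μ + v)) ε
  rw [Module.finrank_fin_fun, abs_of_pos (by positivity), smul_eq_mul] at h2
  have h3 : ∫ v, f (μ + v) = ε ^ m * ∫ w : Fin m → ℝ, f (μ + ε • w) := by
    rw [h2, mul_inv_cancel_left₀ (by positivity)]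
  rw [h3, mul_left_comm]
  congr 1
  rw [← integral_const_mul]
  refine integral_congr_ae (Eventually.of_forall fun w => ?_)
  simp only [hf]
  rw [← Real.exp_add]
  congr 1
  have hb := bregman_eq_integral h.contDiff_legendre μ (ε • w)
  have hp := h.legendre_eq (μ + ε • w)
  rw [h.gradient_legendre] at hb
  have hs : ∫ s in Set.Icc (0 : ℝ) 1,
      s * ((ε • w) ⬝ᵥ hess (legendre φ) (μ + s • ε • w) *ᵥ (ε • w)) =
      ε ^ 2 * ∫ s in Set.Icc (0 : ℝ) 1, s * (w ⬝ᵥ hess (legendre φ) (μ + (s * ε) • w) *ᵥ w) := by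
    rw [← integral_const_mul]
    congr 1
    ext s
    rw [smul_smul s ε w, Matrix.mulVec_smul, smul_dotProduct, dotProduct_smul]
    simp only [smul_eq_mul]
    ring
  rw [hs] at hb
  rw [add_dotProduct] at hp
  generalize ∫ s in Set.Icc (0 : ℝ) 1,
    s * (w ⬝ᵥ hess (legendre φ) (μ + (s * ε) • w) *ᵥ w) = I at *
  linear_combination -(k : ℝ) * (hp + hb) - I * hkε

theorem IsInvariantPotential.sectionNormSq_thetaFun {ψ : (Fin m → ℝ) → ℝ}
    (h : IsInvariantPotential ψ) {k : ℕ} (hk : 1 ≤ k) (j : Fin m → ℤ) :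
    sectionNormSq ψ k (thetaFun k j) =
      ∫ y, Real.exp (-k * (kahlerPotential ψ y - latticePoint k j ⬝ᵥ y +
        (latticePoint k j ⬝ᵥ latticePoint k j) / (8 * Real.pi))) *
          (hess (kahlerPotential ψ) y).det := by
  have hk0 : (0 : ℝ) < k := by exact_mod_cast hk
  have hπ := Real.pi_pos
  have hhess : Continuous fun y => (hess (kahlerPotential ψ) y).det :=
    (continuous_matrix fun i j =>
      (contDiff_hess h.contDiff_kahlerPotential i j).continuous).matrix_det
  have hhper : ∀ (n : Fin m → ℤ) y, hess (kahlerPotential ψ) (y + fun i => (n i : ℝ)) =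
      hess (kahlerPotential ψ) y := fun n y => by
    rw [h.hess_kahlerPotential, h.hess_periodic, ← h.hess_kahlerPotential]
  have hψper : ∀ (n : Fin m → ℤ) y, ψ (y + fun i => (n i : ℝ)) = ψ y := fun n y => by
    simpa using h.periodic n y
  have hdet : ∀ y, (4 * Real.pi) ^ m * (1 + hess ψ y).det = (hess (kahlerPotential ψ) y).det :=
    fun y => by rw [h.hess_kahlerPotential, Matrix.det_smul, Fintype.card_fin]
  set g : (Fin m → ℝ) → ℝ := fun y => Real.exp (-k * (kahlerPotential ψ y - latticePoint k j ⬝ᵥ y +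
        (latticePoint k j ⬝ᵥ latticePoint k j) / (8 * Real.pi))) *
          (hess (kahlerPotential ψ) y).det with hg
  -- Completing the square: the constant `|μ|²/8π` with `μ = -4πj/k` centres the Gaussian at `-j/k`.
  -- Shifting `y` by `n` then replaces `j` by `j + kn`, so `g(y + n)` matches the `n`-th theta term.
  have hexp : ∀ y, -k * (kahlerPotential ψ y - latticePoint k j ⬝ᵥ y +
        (latticePoint k j ⬝ᵥ latticePoint k j) / (8 * Real.pi)) =
      ∑ i, (-2 * Real.pi * k * (y i + j i / k) ^ 2) - 4 * Real.pi * k * ψ y := fun y => by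
    simp only [kahlerPotential, latticePoint, dotProduct]
    have e : ∑ i, (-2 * Real.pi * k * (y i + j i / k) ^ 2) =
        -k * (2 * Real.pi * ∑ i, y i * y i - ∑ i, -(4 * Real.pi * j i) / k * y i +
          (∑ i, -(4 * Real.pi * j i) / k * (-(4 * Real.pi * j i) / k)) / (8 * Real.pi)) := by
      rw [Finset.mul_sum, Finset.sum_div, ← Finset.sum_sub_distrib, ← Finset.sum_add_distrib,
        Finset.mul_sum]
      refine Finset.sum_congr rfl fun i _ => ?_
      field_simp
      ring
    rw [e]
    ring
  -- The factor `exp(-4πkψ) det Hess φ` is periodic, hence bounded, and what is left is a Gaussian.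
  have hgint : Integrable g := by
    obtain ⟨M, hM⟩ := exists_bound_of_periodic (c := 1) one_pos
      (f := fun y => Real.exp (-(4 * Real.pi * k * ψ y)) * (hess (kahlerPotential ψ) y).det)
      ((Real.continuous_exp.comp (continuous_const.mul h.smooth.continuous).neg).mul hhess)
      (fun n y => by simp only [one_mul, hhper, hψper])
    have hI := ((integrable_add_norm_pow_mul_exp_neg (volume : Measure (Fin m → ℝ))
      (c := 2 * Real.pi * k) (by positivity) 0).comp_add_right
        (fun i => (j i : ℝ) / k)).const_mul M
    have hgc : Continuous g := by
      have h1 := h.contDiff_kahlerPotential.continuous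
      have h2 : Continuous fun y : Fin m → ℝ => latticePoint k j ⬝ᵥ y :=
        continuous_const.dotProduct continuous_id
      exact (Real.continuous_exp.comp (continuous_const.mul
        ((h1.sub h2).add continuous_const))).mul hhess
    refine hI.mono' hgc.aestronglyMeasurable (Eventually.of_forall fun y => ?_)
    have hdp := (h.posDef_hess_kahlerPotential y).det_pos
    rw [Real.norm_of_nonneg (mul_nonneg (Real.exp_pos _).le hdp.le), hexp, sub_eq_add_neg,
      Real.exp_add, mul_assoc, mul_comm M, pow_zero, one_mul]
    refine mul_le_mul (Real.exp_le_exp.2 ?_) (hM y)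
      (mul_nonneg (Real.exp_pos _).le hdp.le) (Real.exp_pos _).le
    rw [← Finset.mul_sum, show -2 * Real.pi * k = -(2 * Real.pi * k) by ring, neg_mul]
    refine neg_le_neg (mul_le_mul_of_nonneg_left ?_ (by positivity))
    have h0 : 0 ≤ ∑ i, (y i + j i / k) ^ 2 := Finset.sum_nonneg fun i _ => sq_nonneg _
    have h1 : ‖y + fun i => (j i : ℝ) / k‖ ≤ √(∑ i, (y i + j i / k) ^ 2) := by
      refine (pi_norm_le_iff_of_nonneg (Real.sqrt_nonneg _)).2 fun i => ?_
      rw [Real.norm_eq_abs]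
      refine Real.abs_le_sqrt ?_
      exact Finset.single_le_sum (f := fun i => (y i + (j i : ℝ) / k) ^ 2)
        (fun i _ => sq_nonneg _) (Finset.mem_univ i)
    calc ‖y + fun i => (j i : ℝ) / k‖ ^ 2 ≤ √(∑ i, (y i + j i / k) ^ 2) ^ 2 := by gcongr
      _ = _ := Real.sq_sqrt h0
  have hw : Continuous fun y : Fin m → ℝ =>
      Real.exp (-2 * k * Real.pi * (y ⬝ᵥ y) - 4 * k * Real.pi * ψ y) *
        ((4 * Real.pi) ^ m * (1 + hess ψ y).det) := by
    simp only [hdet]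
    have h1 : Continuous fun y : Fin m → ℝ => y ⬝ᵥ y := continuous_id.dotProduct continuous_id
    exact (Real.continuous_exp.comp ((continuous_const.mul h1).sub
      (continuous_const.mul h.smooth.continuous))).mul hhess
  have hP := hasSum_integral_normSq_thetaFun hk j hw
  have hU := hasSum_setIntegral_unitCube hgint
  have hterm : ∀ (n : Fin m → ℤ) y, thetaCoeff k j n y ^ 2 *
      (Real.exp (-2 * k * Real.pi * (y ⬝ᵥ y) - 4 * k * Real.pi * ψ y) *
        ((4 * Real.pi) ^ m * (1 + hess ψ y).det)) = g (y + fun i => (n i : ℝ)) := by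
    intro n y
    rw [hg]
    dsimp only
    rw [hexp, hhper, hψper, hdet, thetaCoeff, ← Real.exp_nat_mul, ← mul_assoc, ← Real.exp_add]
    congr 2
    simp only [dotProduct, Pi.add_apply]
    rw [Finset.mul_sum, Finset.mul_sum, ← add_sub_assoc, ← Finset.sum_add_distrib]
    congr 1
    · refine Finset.sum_congr rfl fun i _ => ?_
      push_cast
      field_simp
      ring
    · ring
  simp only [hterm] at hP
  rw [sectionNormSq, ← hP.unique hU]
  simp only [mul_assoc]

theorem IsSmoothGeodesic.hess_legendre {ψ : ℝ → (Fin m → ℝ) → ℝ} (h : IsSmoothGeodesic ψ) {t : ℝ}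
    (ht : t ∈ Set.Icc (0 : ℝ) 1) (μ : Fin m → ℝ) :
    hess (legendre (kahlerPotential (ψ t))) μ =
      interpField (hess (legendre (kahlerPotential (ψ 0))))
        (hess (legendre (kahlerPotential (ψ 1)))) t μ := by
  obtain ⟨c₀, h₀⟩ := (h.potential 0 (by simp)).exists_isUniformlyConvex
  obtain ⟨c₁, h₁⟩ := (h.potential 1 (by simp)).exists_isUniformlyConvex
  rw [funext (h.legendre_affine ht), interpField]
  exact hess_linear_comb _ _ h₀.contDiff_legendre h₁.contDiff_legendre μ

theorem IsSmoothGeodesic.normingConst_eq {ψ : ℝ → (Fin m → ℝ) → ℝ} (h : IsSmoothGeodesic ψ) {t : ℝ}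
    (ht : t ∈ Set.Icc (0 : ℝ) 1) {k : ℕ} (hk : 1 ≤ k) (j : Fin m → ℤ) :
    normingConst ψ k j t = Real.exp (k * (legendre (kahlerPotential (ψ t)) (latticePoint k j) -
        (latticePoint k j ⬝ᵥ latticePoint k j) / (8 * Real.pi))) * ((√k)⁻¹ ^ m *
      laplaceIntegral (hess (legendre (kahlerPotential (ψ 0))))
        (hess (legendre (kahlerPotential (ψ 1)))) (latticePoint k j, t, (√k)⁻¹)) := by
  obtain ⟨c, hc⟩ := (h.potential t ht).exists_isUniformlyConvex
  rw [normingConst, (h.potential t ht).sectionNormSq_thetaFun hk j,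
    hc.integral_exp_legendre _ _ hk]
  simp only [laplaceIntegral, bregmanPhase, h.hess_legendre ht]

/-- An exact identity. Because `u_t` is affine in `t` and `|μ|²/8π` is independent of `t`, the
exponential at time `t` is the weighted geometric mean of those at `0` and `1`; the power of
`k^{-1/2}` cancels since `(1-t) + t = 1`. -/
theorem IsSmoothGeodesic.normingRatio_eq {ψ : ℝ → (Fin m → ℝ) → ℝ} (h : IsSmoothGeodesic ψ) {t : ℝ}
    (ht : t ∈ Set.Icc (0 : ℝ) 1) {k : ℕ} (hk : 1 ≤ k) (j : Fin m → ℤ) :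
    normingRatio ψ k j t = laplaceRatio (hess (legendre (kahlerPotential (ψ 0))))
        (hess (legendre (kahlerPotential (ψ 1)))) (latticePoint k j, t, (√k)⁻¹) := by
  have hk0 : (0 : ℝ) < k := by exact_mod_cast hk
  have h₀ := (h.potential 0 (by simp)).isPeriodicMetric
  have h₁ := (h.potential 1 (by simp)).isPeriodicMetric
  obtain ⟨δ, hδ, c, hc, hb⟩ := h₀.exists_interpField_lower_bound h₁
  have hJ : ∀ s ∈ Set.Icc (0 : ℝ) 1, 0 < laplaceIntegral (hess (legendre (kahlerPotential (ψ 0))))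
        (hess (legendre (kahlerPotential (ψ 1)))) (latticePoint k j, s, (√k)⁻¹) := fun s hs =>
    laplaceIntegral_pos h₀ h₁ hc hb ⟨by linarith [hs.1], by linarith [hs.2]⟩
  rw [normingRatio, h.normingConst_eq ht hk, h.normingConst_eq (by simp : (0 : ℝ) ∈ Set.Icc 0 1) hk,
    h.normingConst_eq (by simp : (1 : ℝ) ∈ Set.Icc 0 1) hk, laplaceRatio, h.legendre_affine ht]
  have hJ0 := hJ 0 (by simp)
  have hJ1 := hJ 1 (by simp)
  dsimp only
  generalize laplaceIntegral _ _ (latticePoint k j, t, (√k)⁻¹) = J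
  generalize laplaceIntegral _ _ (latticePoint k j, (0 : ℝ), (√k)⁻¹) = J₀ at *
  generalize laplaceIntegral _ _ (latticePoint k j, (1 : ℝ), (√k)⁻¹) = J₁ at *
  generalize legendre (kahlerPotential (ψ 0)) (latticePoint k j) = u₀
  generalize legendre (kahlerPotential (ψ 1)) (latticePoint k j) = u₁
  generalize (latticePoint k j ⬝ᵥ latticePoint k j) / (8 * Real.pi) = q
  have hε : 0 < (√(k : ℝ))⁻¹ ^ m := by positivity
  generalize (√(k : ℝ))⁻¹ ^ m = d at *
  have hd : d ^ (1 - t) * d ^ t = d := by rw [← Real.rpow_add hε]; simp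
  have hE : Real.exp (k * ((1 - t) * u₀ + t * u₁ - q)) =
      Real.exp (k * (u₀ - q)) ^ (1 - t) * Real.exp (k * (u₁ - q)) ^ t := by
    rw [← Real.exp_mul, ← Real.exp_mul, ← Real.exp_add]
    congr 1
    ring
  have e0 := Real.exp_pos (k * (u₀ - q))
  have e1 := Real.exp_pos (k * (u₁ - q))
  rw [hE, Real.mul_rpow e0.le (by positivity), Real.mul_rpow e1.le (by positivity),
    Real.mul_rpow hε.le hJ0.le, Real.mul_rpow hε.le hJ1.le]
  have p0 := Real.rpow_pos_of_pos e0 (1 - t)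
  have p1 := Real.rpow_pos_of_pos e1 t
  have hden : Real.exp (k * (u₀ - q)) ^ (1 - t) * (d ^ (1 - t) * J₀ ^ (1 - t)) *
      (Real.exp (k * (u₁ - q)) ^ t * (d ^ t * J₁ ^ t)) =
      (Real.exp (k * (u₀ - q)) ^ (1 - t) * Real.exp (k * (u₁ - q)) ^ t * d) *
        (J₀ ^ (1 - t) * J₁ ^ t) := by
    linear_combination (Real.exp (k * (u₀ - q)) ^ (1 - t) * J₀ ^ (1 - t) *
      Real.exp (k * (u₁ - q)) ^ t * J₁ ^ t) * hd
  rw [hden, ← mul_assoc, mul_div_mul_left _ _ (by positivity)]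

theorem IsSmoothGeodesic.limitRatio_eq {ψ : ℝ → (Fin m → ℝ) → ℝ} (h : IsSmoothGeodesic ψ) {t : ℝ}
    (ht : t ∈ Set.Icc (0 : ℝ) 1) (μ : Fin m → ℝ) :
    limitRatio ψ μ t = laplaceRatio (hess (legendre (kahlerPotential (ψ 0))))
        (hess (legendre (kahlerPotential (ψ 1)))) (μ, t, 0) := by
  rw [laplaceRatio_zero (h.potential 0 (by simp)).isPeriodicMetric
    (h.potential 1 (by simp)).isPeriodicMetric ht]
  simp only [limitRatio, detHessLegendre, h.hess_legendre ht]

end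
theorem mainTheorem4 (m : ℕ) (ψ : ℝ → (Fin m → ℝ) → ℝ) (hψ : IsSmoothGeodesic ψ) :
    IsSmoothPeriodicSymbol (limitRatio ψ) ∧
    ∃ a : ℕ → (Fin m → ℝ) → ℝ → ℝ,
      (∀ i, IsSmoothPeriodicSymbol (a i)) ∧
      ∀ ν : ℕ, ∃ C : ℝ, ∀ᶠ k : ℕ in atTop,
        ∀ j : Fin m → ℤ, ∀ t ∈ Set.Icc (0 : ℝ) 1,
          |normingRatio ψ k j t -
              limitRatio ψ (latticePoint k j) t *
                (1 + ∑ i ∈ Finset.Icc 1 ν, a i (latticePoint k j) t / (k : ℝ) ^ i)|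
            ≤ C / (k : ℝ) ^ (ν + 1) := by
  have h₀ := (hψ.potential 0 (by simp)).isPeriodicMetric
  have h₁ := (hψ.potential 1 (by simp)).isPeriodicMetric
  obtain ⟨δ, hδ, hpos, hsmooth⟩ := h₀.exists_laplaceRatio_contDiffOn h₁
  obtain ⟨hlim, a, ha, hexp⟩ := exists_even_expansion hδ hsmooth hpos laplaceRatio_even
    (laplaceRatio_periodic h₀ h₁)
  refine ⟨⟨hlim.1.congr fun p hp => hψ.limitRatio_eq hp.2 p.1, fun t ht n μ => ?_⟩, a, ha,
    fun ν => ?_⟩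
  · dsimp only
    rw [hψ.limitRatio_eq ht, hψ.limitRatio_eq ht]
    exact hlim.2 t ht n μ
  · obtain ⟨C, hC⟩ := hexp ν
    -- Every `k ≥ 1` is admissible: the remainder bound holds for all `ε ∈ [0,1]`, and `ε =
    -- k^{-1/2}` lies there.
    refine ⟨C, (eventually_ge_atTop 1).mono fun k hk j t ht => ?_⟩
    have hk1 : (1 : ℝ) ≤ k := by exact_mod_cast hk
    have hε : (√(k : ℝ))⁻¹ ∈ Set.Icc (0 : ℝ) 1 :=
      ⟨by positivity, inv_le_one_of_one_le₀ (Real.one_le_sqrt.2 hk1)⟩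
    have hsq : (√(k : ℝ))⁻¹ ^ 2 = (k : ℝ)⁻¹ := by rw [inv_pow, Real.sq_sqrt (by linarith)]
    have := hC (latticePoint k j) t ht _ hε
    rw [hψ.normingRatio_eq ht hk, hψ.limitRatio_eq ht]
    simpa only [hsq, inv_pow, ← div_eq_mul_inv] using this
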